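/- **Setting.** Let $n\ge 2$, let $K\subset\mathbb R^n$ be convex, contain a ball of positive radius centred at $0$, and satisfy $K\subset B(0,R)$. Let $0<\delta\le R$ and $0\neq p\in B(0,R)$ (closed Euclidean balls; exact real arithmetic). Put $S(K,t)=\bigcup_{x\in K}B(x,t)$. A weak optimisation oracle for $K$ returns, for a vector $c$ and $\epsilon>0$, a point $y\in S(K,\epsilon)$ with $c^Tx\le c^Ty+\epsilon$ for all $x\in K$. The in-biased weak separation problem asks either to assert $p\in S(K,\delta)$ (the assertion must be true) or to give a unit vector $c$ with $c^Tx\le c^Tp$ for all $x\in K$. **Parameters.** $\epsilon=\delta/5$, $\delta'=2\delta/5$, $\tilde\delta=\delta'/(4R)$, $r=2\delta/(5R)$, $u=2\log_2 n+\log_2(1/r)$, $q_\lambda=1-(1-3\lambda)^{1/3}$, $\rho_0=0.001$, $\zeta_0=q_{\rho_0}$, $\gamma_0=0.25$, $\sigma_0=0.08$, $\nu=1078$. Let $M_p=\{c:\|c\|=1,\ c^Tk+\delta'<c^Tp\ \ \forall k\in S(K,\epsilon)\}$ and $K_p=\mathrm{conv}(M_p\cup\{0\})\setminus\{0\}$.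 **Algorithm.** The state is a point $z$ and a list of hyperplanes $(a_i,b_i)$, $1\le i\le h$, each with a number $\kappa_i$; they define the region $P=\{x:\|x\|\le1,\ a_i^Tx\ge b_i\ \forall i\}$. Let $F(x)=-\sum_{i=1}^h\log(a_i^Tx-b_i)-\log(1-x^Tx)$, $\lambda(x)=\sqrt{\nabla F(x)^T\nabla^2F(x)^{-1}\nabla F(x)}$, $\sigma_i=a_i^T\nabla^2F(z)^{-1}a_i/(a_i^Tz-b_i)^2$, $\mu_i=(a_i^Tz-b_i)/\kappa_i$. Start with the single hyperplane $a_1=p/\|p\|$, $b_1=0$, $\kappa_1=1/\sqrt3$, and $z=a_1/\sqrt3$. To *recentre* means: for the new $F$, starting at $z$, iterate $x\mapsto x-\varsigma\,\nabla^2F(x)^{-1}\nabla F(x)$, where $\varsigma=1/(1+\lambda(x))$ if $\lambda(x)\ge2-\sqrt3$ and $\varsigma=1$ otherwise, up to the first iterate $x$ with $\lambda(x)<\rho_0$ and $q_{\lambda(x)}<\frac{\tilde\delta}{1+\tilde\delta}\frac{\|x\|}{\sqrt2}$, which becomes the new $z$. One iteration does the following. * *Case 1:* some $\mu_i>2$.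 If some $j$ has $\mu_j>2$ and $\sigma_j<\sigma_0$, discard one such $(a_j,b_j)$ and recentre. Otherwise, choose any $j$ with $\mu_j>2$ and reset $\kappa_j:=a_j^Tz-b_j$. * *Case 2:* all $\mu_i\le2$. Let $c=z/\|z\|$ and call the oracle on $(c,\epsilon)$, obtaining $k_c$. If $c^Tp\ge c^Tk_c+\delta/5$, return $c$. Otherwise let $\bar a=(p-k_c)-c^T(p-k_c)\,c$ and $a=\bar a/\|\bar a\|$ (if $\bar a=0$, let $a$ be any unit vector orthogonal to $c$), let $\beta<0$ satisfy $a^T\nabla^2F(z)^{-1}a/(a^Tz-\beta)^2=\gamma_0^2$, add $(a,\beta)$, recentre to obtain the new $z$, and set $\kappa(a,\beta):=a^Tz-\beta$ with this new $z$. After each iteration, stop and assert "$p\in S(K,\delta)$" if Stopping Condition 1, $h\ge\nu nu$, or Stopping Condition 2, $2r>\frac{\min_i(a_i^Tz-b_i)}{1-\zeta_0}(3h+4)$, holds. **Theorem.** There are a universal constant $C>0$ and a real polynomial $Q$ in two variables such that, for all data as above and all choices made during the execution, the following hold. 1. If no separating vector has been returned and neither stopping condition has been met earlier, and if at least $C\,nu\log(nuR/\delta)$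 iterations have been completed without Stopping Condition 1 holding now, then Stopping Condition 2 holds now. That is, if the algorithm does not first find a separating vector or halt by Stopping Condition 1, then Stopping Condition 2 is met within $O(nu\log(nuR/\delta))$ iterations. 2. Whenever Stopping Condition 2 is met, $K_p$ contains no ball of radius $r$, and $p\in S(K,\delta)$ is true. 3. The algorithm never gets stuck: as long as it has not halted, the next iteration can be carried out for every admissible choice (in particular $\beta$ exists and the Newton loop terminates). Every iteration begins after fewer than $C\,nu\log(nuR/\delta)$ completed ones, so the algorithm halts. 4. The algorithm solves the in-biased weak separation problem: every returned $c$ has $\|c\|=1$ and $c^Tx\le c^Tp$ for all $x\in K$, and whenever it asserts $p\in S(K,\delta)$ (by either stopping condition) this is true. It makes at most $Q(n,\log(R/\delta))$ oracle calls. -/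

import Mathlib

noncomputable section

namespace CutPlane

/-- Euclidean space `ℝⁿ`. -/
abbrev E (n : ℕ) := EuclideanSpace ℝ (Fin n)

/-! ### Weak convex-body problems -/

/-- `S(K, t)`: the union of the closed balls of radius `t` centred at the points of `K`. -/
def nbhd {n : ℕ} (K : Set (E n)) (t : ℝ) : Set (E n) :=
  ⋃ x ∈ K, Metric.closedBall x t

/-- `O` answers the weak optimisation problem for `K`: on input `(c, ε)` it returns a point
`y ∈ S(K, ε)` with `cᵀx ≤ cᵀy + ε` for every `x ∈ K`. -/
def IsWeakOptOracle {n : ℕ} (K : Set (E n)) (O : E n → ℝ → E n) : Prop :=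
  ∀ (c : E n) (ε : ℝ), 0 < ε →
    O c ε ∈ nbhd K ε ∧ ∀ x ∈ K, inner ℝ c x ≤ inner ℝ c (O c ε) + ε

/-- The two kinds of answers to the in-biased weak separation problem. -/
inductive Answer (n : ℕ) where
  /-- a normal vector `c` -/
  | hyperplane (c : E n)
  /-- the assertion `p ∈ S(K, δ)` -/
  | near

/-- Correctness of an answer to the in-biased weak separation problem for `(K, p, δ)`. -/
def Answer.Correct {n : ℕ} (K : Set (E n)) (p : E n) (δ : ℝ) : Answer n → Prop
  | .hyperplane c => ‖c‖ = 1 ∧ ∀ x ∈ K, inner ℝ c x ≤ inner ℝ c p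
  | .near => p ∈ nbhd K δ

/-- What the algorithm is given: the point `p`, the outer radius `R`, the accuracy `δ`
and the oracle. -/
structure Input (n : ℕ) where
  p : E n
  R : ℝ
  δ : ℝ
  oracle : E n → ℝ → E n

/-! ### Constants and parameters -/

/-- `q_λ = 1 - (1 - 3λ)^{1/3}` (only used for `λ < 1/3`). -/
def q (l : ℝ) : ℝ := 1 - (1 - 3 * l) ^ (1 / 3 : ℝ)

def ρ₀ : ℝ := 0.001
def ζ₀ : ℝ := q ρ₀
def γ₀ : ℝ := 0.25
def σ₀ : ℝ := 0.08
def ν : ℝ := 1078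

section Parameters

variable {n : ℕ} (I : Input n)

/-- the accuracy with which the oracle is called -/
def Input.ε : ℝ := I.δ / 5

/-- the separation margin `δ'` -/
def Input.δ' : ℝ := 2 * I.δ / 5

/-- `δ̃ = δ' / (4R)` -/
def Input.δt : ℝ := I.δ' / (4 * I.R)

/-- `r = 2δ / (5R)` -/
def Input.r : ℝ := 2 * I.δ / (5 * I.R)

/-- `u = 2 log₂ n + log₂ (1/r)` -/
def Input.u : ℝ := 2 * Real.logb 2 n + Real.logb 2 (1 / I.r)

end Parameters

/-! ### The set of separating vectors -/

/-- The unit vectors separating `p` from `S(K, ε)` with margin `δ'`. -/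
def Mp {n : ℕ} (K : Set (E n)) (I : Input n) : Set (E n) :=
  {c | ‖c‖ = 1 ∧ ∀ k ∈ nbhd K I.ε, inner ℝ c k + I.δ' < inner ℝ c I.p}

/-- The cone-like set spanned by the separating vectors, without the origin. -/
def Kp {n : ℕ} (K : Set (E n)) (I : Input n) : Set (E n) :=
  convexHull ℝ (Mp K I ∪ {0}) \ {0}

/-! ### The barrier, its analytic centre, Newton's method -/

/-- A cutting plane `{x | aᵀx = b}` with its reference distance `κ(a, b)`. -/
structure Cut (n : ℕ) where
  a : E n
  b : ℝ
  kappa : ℝ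

/-- `aᵀx - b` -/
def Cut.dist {n : ℕ} (H : Cut n) (x : E n) : ℝ := inner ℝ H.a x - H.b

/-- `μ(x) = (aᵀx - b) / κ(a, b)` -/
def Cut.μ {n : ℕ} (H : Cut n) (x : E n) : ℝ := H.dist x / H.kappa

section Barrier

variable {n : ℕ} (L : List (Cut n))

/-- `F(x) = -∑ᵢ log (aᵢᵀx - bᵢ) - log (1 - xᵀx)`, the barrier of the search space
`P = {x | ‖x‖ ≤ 1, aᵢᵀx ≥ bᵢ}`. -/
def F (x : E n) : ℝ :=
  -(L.map fun H => Real.log (H.dist x)).sum - Real.log (1 - ‖x‖ ^ 2)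

/-- `∇F(x)` -/
def grad (x : E n) : E n := gradient (F L) x

/-- `∇²F(x)`, as a linear operator -/
def hess (x : E n) : E n →L[ℝ] E n := fderiv ℝ (grad L) x

/-- `(∇²F(x))⁻¹ v` -/
def hessInv (x v : E n) : E n := (hess L x).inverse v

/-- `λ(x) = √(∇F(x)ᵀ (∇²F(x))⁻¹ ∇F(x))` -/
def lam (x : E n) : ℝ := √(inner ℝ (grad L x) (hessInv L x (grad L x)))

/-- `σ(x) = aᵀ (∇²F(x))⁻¹ a / (aᵀx - b)²` for the hyperplane `H = (a, b)` -/
def sig (H : Cut n) (x : E n) : ℝ :=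
  inner ℝ H.a (hessInv L x H.a) / (H.dist x) ^ 2

open Classical in
/-- One Newton step: damped while `λ(x) ≥ 2 - √3`, a full step afterwards. -/
def newtonStep (x : E n) : E n :=
  x - (if 2 - √3 ≤ lam L x then (1 + lam L x)⁻¹ else 1) • hessInv L x (grad L x)

/-- Termination test of the Newton loop, with parameter `δ̃ = d`. -/
def Centred (d : ℝ) (x : E n) : Prop :=
  lam L x < ρ₀ ∧ q (lam L x) < d / (1 + d) * (‖x‖ / √2)

/-- The Newton loop started at `x₀ = z` terminates with the value `z'`: `z'` is the first
Newton iterate that passes the termination test. -/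
def Recentres (d : ℝ) (z z' : E n) : Prop :=
  ∃ k : ℕ, z' = (newtonStep L)^[k] z ∧ Centred L d z' ∧
    ∀ i < k, ¬ Centred L d ((newtonStep L)^[i] z)

end Barrier

/-! ### The algorithm -/

/-- State of the main loop: the hyperplanes defining `P` and the approximate centre `z`. -/
structure State (n : ℕ) where
  cuts : List (Cut n)
  z : E n

section Algorithm

variable {n : ℕ} (I : Input n)

/-- Initialisation: `a₁ = p/‖p‖`, `b₁ = 0`, `κ(a₁, b₁) = 1/√3`, `z = a₁/√3`. -/
def init : State n where
  cuts := [⟨(‖I.p‖)⁻¹ • I.p, 0, 1 / √3⟩]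
  z := (1 / √3) • ((‖I.p‖)⁻¹ • I.p)

/-- Test vector `c = z/‖z‖`. -/
def State.c (s : State n) : E n := (‖s.z‖)⁻¹ • s.z

/-- Oracle answer `k_c`. -/
def State.k (s : State n) : E n := I.oracle s.c I.ε

/-- No hyperplane has more than doubled its distance: the loop body enters Case 2. -/
def State.Case2 (s : State n) : Prop := ∀ H ∈ s.cuts, H.μ s.z ≤ 2

/-- The loop body enters Case 2 and returns `c`. -/
def State.Accepts (s : State n) : Prop :=
  s.Case2 ∧ inner ℝ s.c (s.k I) + I.δ / 5 ≤ inner ℝ s.c I.p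

/-- `a` is the normalisation of `ā = (p - k_c) - cᵀ(p - k_c) c`.  If `ā = 0`, then `a` may be
any unit vector orthogonal to `c`. -/
def State.IsCutNormal (s : State n) (a : E n) : Prop :=
  ‖a‖ = 1 ∧ inner ℝ a s.c = 0 ∧
    ∃ t : ℝ, 0 ≤ t ∧ (I.p - s.k I) - (inner ℝ s.c (I.p - s.k I)) • s.c = t • a

/-- The branches of the loop body that do not return. -/
inductive Branch (s : State n) where
  /-- Subcase 1.1 -/
  | discard (j : Fin s.cuts.length)
  /-- Subcase 1.2 -/
  | reset (j : Fin s.cuts.length)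
  /-- Case 2, with the normal `a` of the new hyperplane -/
  | add (a : E n)

/-- The branches that the loop body may take in state `s`. -/
def Branch.Enabled (s : State n) : Branch s → Prop
  | .discard j => 2 < (s.cuts.get j).μ s.z ∧ sig s.cuts (s.cuts.get j) s.z < σ₀
  | .reset j => 2 < (s.cuts.get j).μ s.z ∧
      ∀ H ∈ s.cuts, ¬ (2 < H.μ s.z ∧ sig s.cuts H s.z < σ₀)
  | .add a => s.Case2 ∧ ¬ s.Accepts I ∧ s.IsCutNormal I a

/-- The loop body, run along the given branch, terminates in state `s'`. -/
def Branch.Result (s : State n) : Branch s → State n → Prop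
  | .discard j, s' => s'.cuts = s.cuts.eraseIdx j ∧ Recentres s'.cuts I.δt s.z s'.z
  | .reset j, s' => s'.z = s.z ∧
      s'.cuts = s.cuts.set j
        ⟨(s.cuts.get j).a, (s.cuts.get j).b, (s.cuts.get j).dist s.z⟩
  | .add a, s' => ∃ β < 0,
      inner ℝ a (hessInv s.cuts s.z a) / (inner ℝ a s.z - β) ^ 2 = γ₀ ^ 2 ∧
      s'.cuts = s.cuts ++ [⟨a, β, inner ℝ a s'.z - β⟩] ∧
      Recentres s'.cuts I.δt s.z s'.z

/-- Number of oracle calls made along a branch. -/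
def Branch.calls {s : State n} : Branch s → ℕ
  | .discard _ => 0
  | .reset _ => 0
  | .add _ => 1

/-- Stopping Condition 1: `h ≥ ν n u`. -/
def State.Stop1 (s : State n) : Prop := ν * n * I.u ≤ s.cuts.length

/-- Stopping Condition 2: `2r > (minᵢ (aᵢᵀz - bᵢ)) / (1 - ζ₀) · (3h + 4)`. -/
def State.Stop2 (s : State n) : Prop :=
  ∃ H ∈ s.cuts, H.dist s.z / (1 - ζ₀) * (3 * s.cuts.length + 4) < 2 * I.r

/-- `Reach I i m s`: some execution has completed exactly `i` iterations of the main loop, made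
exactly `m` oracle calls, is now in state `s`, and the stopping conditions were not met after
any of the iterations before the `i`-th (they are tested after each iteration, and `s` itself
has not been tested yet). -/
inductive Reach : ℕ → ℕ → State n → Prop
  | start : Reach 0 0 (init I)
  | next {i m : ℕ} {s s' : State n} (B : Branch s) :
      Reach i m s → (1 ≤ i → ¬ s.Stop1 I ∧ ¬ s.Stop2 I) →
      B.Enabled I → B.Result I s s' → Reach (i + 1) (m + B.calls) s'

/-- `Active I i m s`: some execution begins its `(i+1)`-st iteration in state `s`, after `m`
oracle calls. -/
def Active (i m : ℕ) (s : State n) : Prop :=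
  Reach I i m s ∧ (1 ≤ i → ¬ s.Stop1 I ∧ ¬ s.Stop2 I)

/-- `Halts I i m ans`: some execution halts in its `i`-th iteration, after `m` oracle calls in
total, with the answer `ans`. -/
inductive Halts : ℕ → ℕ → Answer n → Prop
  | found {i m : ℕ} {s : State n} :
      Active I i m s → s.Accepts I → Halts (i + 1) (m + 1) (.hyperplane s.c)
  | stopped {i m : ℕ} {s : State n} :
      Reach I i m s → 1 ≤ i → s.Stop1 I ∨ s.Stop2 I → Halts i m .near

end Algorithm

end CutPlane

end

/-! Progress is measured by the potential F(z) + Σ log κᵢ at the approximate analytic centre z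
(`State.potential`). Each iteration that does not return raises it by at least 0.003
(`Inv.potential_step`). A reset more than doubles κ and gains log 2. A discard removes -log dist and
log κ together, again gaining log 2, and recentring then costs at most 0.2 because σ < σ₀
(`F_discard`). In an addition the new -log dist and log κ cancel, while the cut pushes the centre
far enough to raise the old barrier (`F_add`). As long as neither stopping condition holds, there
are fewer than νnu cuts and every distance is at least of order r/(nu), so the potential is O(nu
log(nuR/δ)) (`Inv.potential_le`). This bounds the number of iterations.

Correctness rests on the cuts never removing a vector m of M_p. At the exact centre ω, stationarity
makes ω a positive combination of the normals, so ωᵀm ≥ 0. The recentring test keeps z close enough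
to ω for the next projected normal to satisfy aᵀm > 0 (`Inv.inner_cutNormal_pos`). Stationarity also
shows that no distance on P exceeds h + 1 times its value at ω, so a ball inside P forces all
distances at z to be large (`Inv.width`). If p ∉ S(K,δ), Hahn–Banach yields such a ball of radius
r/3 (`Valid.exists_ball`). Stopping Condition 2 contradicts that ball, and equally a ball of radius
r in K_p.

For Stopping Condition 1, suppose p ∉ S(K,δ). The matrix 8I + Σ aaᵀ/κ² does not change when z moves,
and it is dominated by four times the Hessian whenever all μ ≤ 2. Each counted cut multiplies its
determinant by at least 1.01, while the lower bound `kappaMin` on κ keeps its trace small. Having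
νnu cuts is therefore impossible (`Valid.not_card_bound`, `FarInv.step`).

Self-concordance is used in an elementary form: along a line exp(-F) is a product of affine factors
(`exists_slopes`), so every estimate reduces to one about log(1 + y). -/

noncomputable section

namespace CutPlane

variable {n : ℕ}

/-! ### Derivatives of the barrier -/

/-- The interior of the search space: the domain on which the barrier is smooth. -/
def dom (L : List (Cut n)) : Set (E n) := {x | (∀ H ∈ L, 0 < H.dist x) ∧ ‖x‖ < 1}

lemma Cut.continuous_dist (H : Cut n) : Continuous H.dist := by
  unfold Cut.dist; fun_prop

lemma dom_cons (H : Cut n) (L : List (Cut n)) :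
    dom (H :: L) = {x | 0 < H.dist x} ∩ dom L := by
  ext x; simp [dom, and_assoc]

lemma dom_nil : dom ([] : List (Cut n)) = {x | ‖x‖ < 1} := by
  ext x; simp [dom]

lemma isOpen_dom (L : List (Cut n)) : IsOpen (dom L) := by
  induction L with
  | nil => rw [dom_nil]; exact isOpen_lt continuous_norm continuous_const
  | cons H L ih =>
    rw [dom_cons]; exact (isOpen_lt continuous_const H.continuous_dist).inter ih

lemma one_sub_normSq_pos {x : E n} (hx : ‖x‖ < 1) : 0 < 1 - ‖x‖ ^ 2 := by
  nlinarith [norm_nonneg x]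

lemma F_cons (H : Cut n) (L : List (Cut n)) (x : E n) :
    F (H :: L) x = F L x - Real.log (H.dist x) := by
  simp only [F, List.map_cons, List.sum_cons]; ring

/-- The closed form of the gradient of the barrier. -/
def gradForm : List (Cut n) → E n → E n
  | [], x => (2 / (1 - ‖x‖ ^ 2)) • x
  | H :: L, x => gradForm L x - (H.dist x)⁻¹ • H.a

/-- The closed form of the Hessian of the barrier. -/
def hessForm : List (Cut n) → E n → E n →L[ℝ] E n
  | [], x => (2 / (1 - ‖x‖ ^ 2)) • ContinuousLinearMap.id ℝ (E n) +
      (4 / (1 - ‖x‖ ^ 2) ^ 2) • (innerSL ℝ x).smulRight x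
  | H :: L, x => hessForm L x + ((H.dist x) ^ 2)⁻¹ • (innerSL ℝ H.a).smulRight H.a

lemma Cut.hasFDerivAt_dist (H : Cut n) (x : E n) :
    HasFDerivAt H.dist (innerSL ℝ H.a) x := by
  have h := (innerSL ℝ H.a).hasFDerivAt (x := x)
  exact h.sub_const H.b

lemma hasFDerivAt_one_sub_normSq (x : E n) :
    HasFDerivAt (fun y : E n => 1 - ‖y‖ ^ 2) (-(2 • innerSL ℝ x)) x :=
  ((hasStrictFDerivAt_norm_sq x).hasFDerivAt.const_sub 1)

lemma hasFDerivAt_F {L : List (Cut n)} {x : E n} (hx : x ∈ dom L) :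
    HasFDerivAt (F L) (innerSL ℝ (gradForm L x)) x := by
  induction L with
  | nil =>
    rw [dom_nil] at hx
    have hw := one_sub_normSq_pos hx
    have h := ((hasFDerivAt_one_sub_normSq x).log hw.ne').neg
    have e : F ([] : List (Cut n)) = -fun y => Real.log (1 - ‖y‖ ^ 2) := by
      funext y; simp [F]
    rw [e]
    refine h.congr_fderiv ?_
    ext v
    simp [gradForm]
    ring
  | cons H L ih =>
    rw [dom_cons] at hx
    have h := (ih hx.2).sub ((H.hasFDerivAt_dist x).log (ne_of_gt hx.1))
    have e : F (H :: L) = F L - fun y => Real.log (H.dist y) := by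
      funext y; simp [F_cons]
    rw [e]
    refine h.congr_fderiv ?_
    ext v
    simp [gradForm]

/-- `gradient` and `fderiv` return 0 where there is no derivative, so the closed forms are claimed
only on `dom`. All iterates are later shown to stay there. -/
lemma grad_eq {L : List (Cut n)} {x : E n} (hx : x ∈ dom L) : grad L x = gradForm L x := by
  refine HasGradientAt.gradient ?_
  rw [hasGradientAt_iff_hasFDerivAt]
  exact hasFDerivAt_F hx

lemma hasFDerivAt_gradForm {L : List (Cut n)} {x : E n} (hx : x ∈ dom L) :
    HasFDerivAt (gradForm L) (hessForm L x) x := by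
  induction L with
  | nil =>
    rw [dom_nil] at hx
    have hw := one_sub_normSq_pos hx
    have h := (((hasDerivAt_inv hw.ne').comp_hasFDerivAt x
      (hasFDerivAt_one_sub_normSq x)).const_mul 2).smul
      (hasFDerivAt_id (𝕜 := ℝ) x)
    have e : gradForm ([] : List (Cut n)) =
        (fun y : E n => 2 * (1 - ‖y‖ ^ 2)⁻¹) • fun y : E n => id y := by
      funext y; simp [gradForm, div_eq_mul_inv]
    rw [e]
    refine h.congr_fderiv ?_
    ext1 v
    simp [hessForm, smul_smul, div_eq_mul_inv]
    ring_nf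
  | cons H L ih =>
    rw [dom_cons] at hx
    have hd : H.dist x ≠ 0 := ne_of_gt hx.1
    have h := (ih hx.2).sub (((hasDerivAt_inv hd).comp_hasFDerivAt x (H.hasFDerivAt_dist x)).smul_const H.a)
    have e : gradForm (H :: L) = gradForm L - fun y => (H.dist y)⁻¹ • H.a := by
      funext y; simp [gradForm]
    rw [e]
    refine h.congr_fderiv ?_
    ext1 v
    simp [hessForm, smul_smul]

lemma hess_eq {L : List (Cut n)} {x : E n} (hx : x ∈ dom L) : hess L x = hessForm L x := by
  have h : grad L =ᶠ[nhds x] gradForm L := by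
    filter_upwards [(isOpen_dom L).mem_nhds hx] with y hy using grad_eq hy
  exact (h.fderiv_eq).trans (hasFDerivAt_gradForm hx).fderiv

lemma continuousOn_F (L : List (Cut n)) : ContinuousOn (F L) (dom L) :=
  fun _ hx => (hasFDerivAt_F hx).continuousAt.continuousWithinAt

/-! ### The Hessian as a quadratic form -/

lemma inner_hessForm_comm (L : List (Cut n)) (x v w : E n) :
    inner ℝ (hessForm L x v) w = inner ℝ v (hessForm L x w) := by
  induction L with
  | nil =>
    simp [hessForm, inner_add_left, inner_add_right, inner_smul_left, inner_smul_right]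
    left; rw [real_inner_comm x v]; ring
  | cons H L ih =>
    simp [hessForm, inner_add_left, inner_add_right, inner_smul_left, inner_smul_right, ih]
    left; rw [real_inner_comm v H.a]; ring

lemma two_mul_normSq_le {L : List (Cut n)} {x : E n} (hx : x ∈ dom L) (v : E n) :
    2 / (1 - ‖x‖ ^ 2) * ‖v‖ ^ 2 ≤ inner ℝ (hessForm L x v) v := by
  induction L with
  | nil =>
    simp only [hessForm, add_apply, smul_apply,
      ContinuousLinearMap.id_apply, ContinuousLinearMap.smulRight_apply, innerSL_apply_apply,
      inner_add_left, real_inner_smul_left, real_inner_self_eq_norm_sq]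
    have : 0 ≤ inner ℝ x v * inner ℝ x v := mul_self_nonneg _
    have : 0 ≤ 4 / (1 - ‖x‖ ^ 2) ^ 2 * (inner ℝ x v * inner ℝ x v) := by positivity
    linarith
  | cons H L ih =>
    rw [dom_cons] at hx
    refine (ih hx.2).trans ?_
    simp only [hessForm, add_apply, smul_apply,
      ContinuousLinearMap.smulRight_apply, innerSL_apply_apply,
      inner_add_left, real_inner_smul_left]
    have : 0 ≤ inner ℝ H.a v * inner ℝ H.a v := mul_self_nonneg _
    have : 0 ≤ ((H.dist x) ^ 2)⁻¹ * (inner ℝ H.a v * inner ℝ H.a v) := by positivity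
    linarith

/-- The term -log(1 - ‖x‖²) alone makes the Hessian at least 2I. This 2 is behind the √2 of the
recentring test and the 8I of `gram`. -/
lemma two_normSq_le {L : List (Cut n)} {x : E n} (hx : x ∈ dom L) (v : E n) :
    2 * ‖v‖ ^ 2 ≤ inner ℝ (hessForm L x v) v := by
  refine le_trans ?_ (two_mul_normSq_le hx v)
  have hw := one_sub_normSq_pos hx.2
  gcongr
  rw [le_div_iff₀ hw]; nlinarith [norm_nonneg x]

/-- The square `vᵀ ∇²F(x) v` of the local norm. -/
def sqn (L : List (Cut n)) (x v : E n) : ℝ := inner ℝ (hessForm L x v) v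

lemma sqn_nonneg {L : List (Cut n)} {x : E n} (hx : x ∈ dom L) (v : E n) : 0 ≤ sqn L x v :=
  le_trans (by positivity) (two_normSq_le hx v)

lemma sqn_smul (L : List (Cut n)) (x v : E n) (c : ℝ) : sqn L x (c • v) = c ^ 2 * sqn L x v := by
  simp [sqn, inner_smul_left, inner_smul_right]; ring

lemma sqn_cons (H : Cut n) (L : List (Cut n)) (x v : E n) :
    sqn (H :: L) x v = sqn L x v + (inner ℝ H.a v / H.dist x) ^ 2 := by
  simp [sqn, hessForm, inner_add_left, inner_smul_left]
  ring

/-- `ContinuousLinearMap.inverse` is 0 on non-invertible maps. Positive definiteness gives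
injectivity, hence a genuine inverse in finite dimension. -/
lemma hessForm_hessInv {L : List (Cut n)} {x : E n} (hx : x ∈ dom L) (v : E n) :
    hessForm L x (hessInv L x v) = v := by
  have hinj : Function.Injective (hessForm L x) := by
    rw [injective_iff_map_eq_zero]
    intro w hw
    have h := two_normSq_le hx w
    rw [hw, inner_zero_left] at h
    have : ‖w‖ = 0 := by nlinarith [norm_nonneg w]
    simpa using this
  have hinj' : Function.Injective (hessForm L x : E n →ₗ[ℝ] E n) := hinj
  let e := (LinearEquiv.ofInjectiveEndo (hessForm L x : E n →ₗ[ℝ] E n)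
    hinj').toContinuousLinearEquiv
  have he : (e : E n →L[ℝ] E n) = hessForm L x := by
    ext1 w; rfl
  rw [hessInv, hess_eq hx, ← he, ContinuousLinearMap.inverse_equiv]
  simp

lemma sqn_hessInv {L : List (Cut n)} {x : E n} (hx : x ∈ dom L) (v : E n) :
    sqn L x (hessInv L x v) = inner ℝ v (hessInv L x v) := by
  rw [sqn, hessForm_hessInv hx]

lemma inner_hessInv_nonneg {L : List (Cut n)} {x : E n} (hx : x ∈ dom L) (v : E n) :
    0 ≤ inner ℝ v (hessInv L x v) := by
  rw [← sqn_hessInv hx]; exact sqn_nonneg hx _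

/-- Cauchy–Schwarz for a pair of dual local norms. -/
lemma sq_inner_le {L : List (Cut n)} {x : E n} (hx : x ∈ dom L) (u v : E n) :
    (inner ℝ u v) ^ 2 ≤ inner ℝ u (hessInv L x u) * sqn L x v := by
  set w := hessInv L x u
  have hw : hessForm L x w = u := hessForm_hessInv hx u
  have key : ∀ s : ℝ, 0 ≤ sqn L x v * (s * s) + (2 * inner ℝ u v) * s + inner ℝ u w := by
    intro s
    have h := sqn_nonneg hx (w + s • v)
    have e : sqn L x (w + s • v) =
        sqn L x v * (s * s) + (2 * inner ℝ u v) * s + inner ℝ u w := by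
      have h1 : inner ℝ (hessForm L x v) w = inner ℝ u v := by
        rw [inner_hessForm_comm, hw, real_inner_comm]
      simp [sqn, inner_add_left, inner_add_right, inner_smul_left, inner_smul_right, hw, h1]
      ring
    rwa [e] at h
  have h := discrim_le_zero key
  rw [discrim] at h
  nlinarith

lemma inner_hessInv_le {L : List (Cut n)} {x : E n} (hx : x ∈ dom L) (u : E n) :
    inner ℝ u (hessInv L x u) ≤ ‖u‖ ^ 2 / 2 := by
  set w := hessInv L x u
  have h1 := two_normSq_le hx w
  rw [hessForm_hessInv hx u] at h1
  have h2 := real_inner_le_norm u w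
  have := norm_nonneg u
  have := norm_nonneg w
  nlinarith [sq_nonneg (‖u‖ - 2 * ‖w‖)]

lemma inner_hessInv_pos {L : List (Cut n)} {x : E n} (hx : x ∈ dom L) {u : E n} (hu : u ≠ 0) :
    0 < inner ℝ u (hessInv L x u) := by
  have h1 := two_normSq_le hx (hessInv L x u)
  rw [hessForm_hessInv hx u] at h1
  have h2 : hessInv L x u ≠ 0 := by
    intro h
    have := hessForm_hessInv hx u
    rw [h, map_zero] at this
    exact hu this.symm
  have : 0 < ‖hessInv L x u‖ := norm_pos_iff.2 h2
  have : 0 < ‖hessInv L x u‖ ^ 2 := by positivity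
  linarith

lemma lam_nonneg (L : List (Cut n)) (x : E n) : 0 ≤ lam L x := Real.sqrt_nonneg _

lemma lam_sq {L : List (Cut n)} {x : E n} (hx : x ∈ dom L) :
    lam L x ^ 2 = inner ℝ (gradForm L x) (hessInv L x (gradForm L x)) := by
  rw [lam, grad_eq hx, Real.sq_sqrt (inner_hessInv_nonneg hx _)]

lemma abs_inner_gradForm_le {L : List (Cut n)} {x : E n} (hx : x ∈ dom L) (v : E n) :
    |inner ℝ (gradForm L x) v| ≤ lam L x * √(sqn L x v) := by
  apply abs_le_of_sq_le_sq
  · rw [mul_pow, Real.sq_sqrt (sqn_nonneg hx v), lam_sq hx]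
    exact sq_inner_le hx _ v
  · exact mul_nonneg (lam_nonneg _ _) (Real.sqrt_nonneg _)

/-! ### Self-concordance -/

/-- The function `(y - log (1 + y)) / y²` is antitone on `(-1, ∞)`. -/
lemma sub_log_mul_sq_le {x y : ℝ} (hx : 0 < 1 + x) (hxy : x ≤ y) :
    (y - Real.log (1 + y)) * x ^ 2 ≤ (x - Real.log (1 + x)) * y ^ 2 := by
  have pos : ∀ z : ℝ, 0 < 1 + z → ∀ s ∈ Set.Icc (0 : ℝ) 1, 0 < 1 + s * z := by
    intro z hz s hs
    rcases le_or_gt 0 z with h | h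
    · have := mul_nonneg hs.1 h; linarith
    · nlinarith [hs.1, hs.2]
  have hy : 0 < 1 + y := by linarith
  have hd : ∀ z : ℝ, 0 < 1 + z → ∀ s ∈ Set.Icc (0 : ℝ) 1,
      HasDerivAt (fun s => s * z - Real.log (1 + s * z)) (z - z / (1 + s * z)) s := by
    intro z hz s hs
    have h1 : HasDerivAt (fun s : ℝ => s * z) z s := by
      simpa using (hasDerivAt_id s).mul_const z
    exact h1.sub ((h1.const_add 1).log (pos z hz s hs).ne')
  -- Cross-multiplying avoids dividing by zero. Scaling both arguments by s gives the derivative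
  -- s²x²y²(y - x)/((1 + sx)(1 + sy)) ≥ 0.
  have hG : ∀ s ∈ Set.Icc (0 : ℝ) 1, HasDerivAt
      (fun s => (s * x - Real.log (1 + s * x)) * y ^ 2 - (s * y - Real.log (1 + s * y)) * x ^ 2)
      ((x - x / (1 + s * x)) * y ^ 2 - (y - y / (1 + s * y)) * x ^ 2) s := fun s hs =>
    ((hd x hx s hs).mul_const _).sub ((hd y hy s hs).mul_const _)
  have hmono := monotoneOn_of_deriv_nonneg (convex_Icc (0 : ℝ) 1)
    (f := fun s => (s * x - Real.log (1 + s * x)) * y ^ 2 -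
      (s * y - Real.log (1 + s * y)) * x ^ 2)
    (fun s hs => (hG s hs).continuousAt.continuousWithinAt)
    (fun s hs => (hG s (interior_subset hs)).differentiableAt.differentiableWithinAt)
    (by
      intro s hs
      have hs' := interior_subset hs
      rw [(hG s hs').deriv]
      have p1 := pos x hx s hs'
      have p2 := pos y hy s hs'
      have e : (x - x / (1 + s * x)) * y ^ 2 - (y - y / (1 + s * y)) * x ^ 2 =
          s ^ 2 * (x ^ 2 * y ^ 2) * (y - x) / ((1 + s * x) * (1 + s * y)) := by
        rw [eq_div_iff (mul_pos p1 p2).ne']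
        linear_combination -(y ^ 2 * (1 + s * y)) * div_mul_cancel₀ x p1.ne' +
          (x ^ 2 * (1 + s * x)) * div_mul_cancel₀ y p2.ne'
      rw [e]
      have : 0 ≤ y - x := by linarith
      positivity)
  have := hmono (Set.left_mem_Icc.2 zero_le_one) (Set.right_mem_Icc.2 zero_le_one) zero_le_one
  simp at this
  linarith

/-- Along a line the barrier is a sum of logarithms of affine functions. -/
lemma exists_slopes {L : List (Cut n)} {x : E n} (hx : x ∈ dom L) (v : E n) :
    ∃ l : List ℝ, l.sum = -inner ℝ (gradForm L x) v ∧ (l.map (· ^ 2)).sum = sqn L x v ∧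
      (x + v ∈ dom L ↔ ∀ y ∈ l, 0 < 1 + y) ∧
      (x + v ∈ dom L → F L (x + v) = F L x - (l.map fun y => Real.log (1 + y)).sum ∧
        inner ℝ (gradForm L (x + v)) v = -(l.map fun y => y / (1 + y)).sum) := by
  induction L with
  | nil =>
    rw [dom_nil] at hx
    have hw := one_sub_normSq_pos hx
    set w := 1 - ‖x‖ ^ 2
    set A := inner ℝ x v / w
    set B := ‖v‖ ^ 2 / w
    have hB : 0 ≤ B := by positivity
    -- 1 - ‖x + sv‖² = w(1 - 2As - Bs²) has real roots since B ≥ 0, so the ball contributes the two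
    -- slopes -A ± r.
    have hr := Real.sq_sqrt (by positivity : 0 ≤ A ^ 2 + B)
    set r := √(A ^ 2 + B)
    have hAx : inner ℝ x v = A * w := by simp only [A]; field_simp
    have hBv : ‖v‖ ^ 2 = B * w := by simp only [B]; field_simp
    have hmul : (1 + (-A + r)) * (1 + (-A - r)) = 1 - 2 * A - B := by nlinarith
    have hxv : 1 - ‖x + v‖ ^ 2 = w * ((1 + (-A + r)) * (1 + (-A - r))) := by
      rw [norm_add_sq_real, hAx, hBv, hmul]
      simp only [w]; ring
    have hiff : x + v ∈ dom ([] : List (Cut n)) ↔ ∀ y ∈ [-A + r, -A - r], 0 < 1 + y := by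
      rw [dom_nil]
      simp only [Set.mem_ofPred_eq, List.mem_cons, List.not_mem_nil, or_false, forall_eq_or_imp,
        forall_eq]
      constructor
      · intro h
        have h1 := one_sub_normSq_pos h
        rw [hxv] at h1
        have h2 := (mul_pos_iff_of_pos_left hw).1 h1
        rcases mul_pos_iff.1 h2 with h3 | h3
        · exact h3
        -- Both factors cannot be negative, because r ≥ |A| gives -A + r ≥ 0.
        · nlinarith [h3.1, h3.2]
      · rintro ⟨h1, h2⟩
        have h3 := mul_pos hw (mul_pos h1 h2)
        rw [← hxv] at h3
        nlinarith [norm_nonneg (x + v)]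
    refine ⟨[-A + r, -A - r], ?_, ?_, hiff, ?_⟩
    · simp only [gradForm, real_inner_smul_left, hAx, List.sum_cons, List.sum_nil]
      rw [show 1 - ‖x‖ ^ 2 = w from rfl]
      field_simp
      ring
    · simp only [sqn, hessForm, add_apply, smul_apply, ContinuousLinearMap.id_apply,
        ContinuousLinearMap.smulRight_apply, innerSL_apply_apply, inner_add_left,
        real_inner_smul_left, real_inner_self_eq_norm_sq, hAx, hBv, List.map_cons, List.map_nil,
        List.sum_cons, List.sum_nil]
      rw [show 1 - ‖x‖ ^ 2 = w from rfl]
      field_simp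
      nlinarith
    · intro h
      have h1 := hiff.1 h
      simp only [List.mem_cons, List.not_mem_nil, or_false, forall_eq_or_imp, forall_eq] at h1
      constructor
      · simp only [F, List.map_nil, List.sum_nil, List.map_cons, List.sum_cons, hxv]
        rw [Real.log_mul hw.ne' (mul_pos h1.1 h1.2).ne', Real.log_mul h1.1.ne' h1.2.ne']
        simp only [w]; ring
      · simp only [gradForm, List.map_nil, List.sum_nil, List.map_cons, List.sum_cons,
          real_inner_smul_left, inner_add_left, hAx, real_inner_self_eq_norm_sq, hBv, hxv]
        have e1 := h1.1.ne'
        have e2 := h1.2.ne'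
        generalize ha : -A + r = a at *
        generalize hb : -A - r = b at *
        have e3 : A = -(a + b) / 2 := by linarith
        have e4 : B = -(a * b) := by nlinarith
        rw [e3, e4]
        field_simp
        ring
  | cons H L ih =>
    rw [dom_cons] at hx
    obtain ⟨l, h1, h2, h3, h4⟩ := ih hx.2
    have hd : 0 < H.dist x := hx.1
    have hdv : H.dist (x + v) = H.dist x * (1 + inner ℝ H.a v / H.dist x) := by
      field_simp
      simp [Cut.dist, inner_add_right]; ring
    refine ⟨(inner ℝ H.a v / H.dist x) :: l, ?_, ?_, ?_, ?_⟩
    · simp [h1, gradForm, inner_sub_left, inner_smul_left]; ring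
    · rw [List.map_cons, List.sum_cons, h2, sqn_cons]; ring
    · rw [dom_cons]
      simp only [Set.mem_inter_iff, Set.mem_ofPred_eq, List.mem_cons, forall_eq_or_imp, h3, hdv,
        mul_pos_iff_of_pos_left hd]
    · intro h
      rw [dom_cons] at h
      obtain ⟨h5, h6⟩ := h4 h.2
      have hp : 0 < 1 + inner ℝ H.a v / H.dist x := by
        have : 0 < H.dist (x + v) := h.1
        rwa [hdv, mul_pos_iff_of_pos_left hd] at this
      constructor
      · rw [F_cons, F_cons, h5, List.map_cons, List.sum_cons, hdv, Real.log_mul hd.ne' hp.ne']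
        ring
      · rw [gradForm, inner_sub_left, h6, List.map_cons, List.sum_cons, hdv, real_inner_smul_left]
        have := hp.ne'
        field_simp
        ring

lemma sq_le_sum_sq {l : List ℝ} {y : ℝ} (hy : y ∈ l) : y ^ 2 ≤ (l.map (· ^ 2)).sum :=
  List.single_le_sum (by simp; intros; positivity) _ (List.mem_map_of_mem hy)

/-- Each slope is compared with the common bound t by monotonicity of (y - log(1 + y))/y². Summing
leaves only Σy, the directional derivative, and Σy², the local norm. -/
lemma sum_log_add_le {l : List ℝ} {t : ℝ} (h : ∀ y ∈ l, 0 < 1 + y ∧ y ≤ t) :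
    (l.map fun y => Real.log (1 + y)).sum * t ^ 2 ≤
      l.sum * t ^ 2 - (t - Real.log (1 + t)) * (l.map (· ^ 2)).sum := by
  induction l with
  | nil => simp
  | cons y l ih =>
    have h1 := ih fun z hz => h z (List.mem_cons_of_mem _ hz)
    have h2 := h y List.mem_cons_self
    have h3 := sub_log_mul_sq_le h2.1 h2.2
    simp only [List.map_cons, List.sum_cons]
    linarith

lemma le_sum_log_add {l : List ℝ} {t : ℝ} (ht : t < 1) (h : ∀ y ∈ l, -t ≤ y) :
    l.sum * t ^ 2 - (-t - Real.log (1 - t)) * (l.map (· ^ 2)).sum ≤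
      (l.map fun y => Real.log (1 + y)).sum * t ^ 2 := by
  induction l with
  | nil => simp
  | cons y l ih =>
    have h1 := ih fun z hz => h z (List.mem_cons_of_mem _ hz)
    have h2 := h y List.mem_cons_self
    have h3 := sub_log_mul_sq_le (x := -t) (by linarith) h2
    rw [← sub_eq_add_neg, neg_sq] at h3
    simp only [List.map_cons, List.sum_cons]
    linarith

lemma eq_zero_of_sqn_eq_zero {L : List (Cut n)} {x v : E n} (hx : x ∈ dom L) (h : sqn L x v = 0) :
    v = 0 := by
  have := two_normSq_le hx v
  rw [← sqn, h] at this
  have : ‖v‖ = 0 := by nlinarith [norm_nonneg v]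
  simpa using this

/-- The lower self-concordance bound. -/
lemma F_lower {L : List (Cut n)} {x v : E n} (hx : x ∈ dom L) (hxv : x + v ∈ dom L) :
    F L x + inner ℝ (gradForm L x) v + √(sqn L x v) - Real.log (1 + √(sqn L x v)) ≤
      F L (x + v) := by
  obtain ⟨l, h1, h2, h3, h4⟩ := exists_slopes hx v
  have hs := sqn_nonneg hx v
  rcases hs.eq_or_lt with h | h
  · rw [← h, eq_zero_of_sqn_eq_zero hx h.symm]; simp
  · have ht : 0 < √(sqn L x v) := Real.sqrt_pos.2 h
    have hsq := Real.sq_sqrt hs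
    set t := √(sqn L x v)
    have hb := sum_log_add_le (l := l) (t := t) fun y hy =>
      ⟨h3.1 hxv y hy, by
        have := sq_le_sum_sq hy
        rw [h2, ← hsq] at this
        exact le_of_sq_le_sq this ht.le⟩
    rw [h2, ← hsq, ← sub_mul] at hb
    have hb := le_of_mul_le_mul_right hb (by positivity)
    rw [(h4 hxv).1]
    linarith

lemma neg_le_of_sq_le {y t : ℝ} (ht : 0 ≤ t) (h : y ^ 2 ≤ t ^ 2) : -t ≤ y :=
  (abs_le.1 (abs_le_of_sq_le_sq h ht)).1

/-- The Dikin ellipsoid lies in the domain. -/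
lemma add_mem_dom {L : List (Cut n)} {x v : E n} (hx : x ∈ dom L) (ht : sqn L x v < 1) :
    x + v ∈ dom L := by
  obtain ⟨l, h1, h2, h3, h4⟩ := exists_slopes hx v
  refine h3.2 fun y hy => ?_
  have := sq_le_sum_sq hy
  rw [h2] at this
  nlinarith

/-- The upper self-concordance bound. -/
lemma F_upper {L : List (Cut n)} {x v : E n} (hx : x ∈ dom L) (hv : sqn L x v < 1) :
    F L (x + v) ≤
      F L x + inner ℝ (gradForm L x) v - √(sqn L x v) - Real.log (1 - √(sqn L x v)) := by
  have hxv := add_mem_dom hx hv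
  obtain ⟨l, h1, h2, h3, h4⟩ := exists_slopes hx v
  have hs := sqn_nonneg hx v
  rcases hs.eq_or_lt with h | h
  · rw [← h, eq_zero_of_sqn_eq_zero hx h.symm]; simp
  · have ht : 0 < √(sqn L x v) := Real.sqrt_pos.2 h
    have hsq := Real.sq_sqrt hs
    set t := √(sqn L x v)
    have ht1 : t < 1 := by nlinarith
    have hb := le_sum_log_add ht1 (l := l) fun y hy => by
        have := sq_le_sum_sq hy
        rw [h2, ← hsq] at this
        exact neg_le_of_sq_le ht.le this
    rw [h2, ← hsq, ← sub_mul] at hb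
    have hb := le_of_mul_le_mul_right hb (by positivity)
    rw [(h4 hxv).1]
    linarith

/-- Strong monotonicity of the gradient of the barrier. -/
lemma inner_gradForm_sub {L : List (Cut n)} {x v : E n} (hx : x ∈ dom L) (hxv : x + v ∈ dom L) :
    sqn L x v / (1 + √(sqn L x v)) ≤
      inner ℝ (gradForm L (x + v)) v - inner ℝ (gradForm L x) v := by
  obtain ⟨l, h1, h2, h3, h4⟩ := exists_slopes hx v
  have hs := sqn_nonneg hx v
  have hsq := Real.sq_sqrt hs
  have ht := Real.sqrt_nonneg (sqn L x v)
  set t := √(sqn L x v)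
  rw [(h4 hxv).2, ← h2]
  have e : -inner ℝ (gradForm L x) v = l.sum := h1.symm
  rw [sub_eq_add_neg, e]
  have hl : ∀ y ∈ l, 0 < 1 + y ∧ y ≤ t := fun y hy => ⟨h3.1 hxv y hy, by
        have := sq_le_sum_sq hy
        rw [h2, ← hsq] at this
        exact le_of_sq_le_sq this ht⟩
  clear h1 h2 h3 h4 e
  induction l with
  | nil => simp
  | cons y l ih =>
    have i1 := ih fun z hz => hl z (List.mem_cons_of_mem _ hz)
    obtain ⟨i2, i3⟩ := hl y List.mem_cons_self
    simp only [List.map_cons, List.sum_cons, add_div]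
    have i4 : y ^ 2 / (1 + t) ≤ y ^ 2 / (1 + y) := by gcongr
    have i5 : y ^ 2 / (1 + y) = -(y / (1 + y)) + y := by field_simp; ring
    linarith

lemma sq_slope_le {L : List (Cut n)} {x : E n} (hx : x ∈ dom L) (v : E n) {H : Cut n}
    (hH : H ∈ L) : (inner ℝ H.a v / H.dist x) ^ 2 ≤ sqn L x v := by
  induction L with
  | nil => simp at hH
  | cons G L ih =>
    rw [dom_cons] at hx
    rw [sqn_cons]
    rcases List.mem_cons.1 hH with rfl | h
    · linarith [sqn_nonneg hx.2 v]
    · linarith [ih hx.2 h, sq_nonneg (inner ℝ G.a v / G.dist x)]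

lemma dist_add (H : Cut n) (x v : E n) : H.dist (x + v) = H.dist x + inner ℝ H.a v := by
  simp [Cut.dist, inner_add_right]; ring

lemma abs_inner_le_dist {L : List (Cut n)} {x : E n} (hx : x ∈ dom L) (v : E n) {H : Cut n}
    (hH : H ∈ L) : |inner ℝ H.a v| ≤ H.dist x * √(sqn L x v) := by
  have hd := hx.1 H hH
  have h := sq_slope_le hx v hH
  rw [div_pow, div_le_iff₀ (by positivity)] at h
  apply abs_le_of_sq_le_sq
  · rw [mul_pow, Real.sq_sqrt (sqn_nonneg hx v)]; linarith
  · positivity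

lemma one_sub_normSq_add_le {L : List (Cut n)} {x : E n} (hx : x ∈ dom L) (v : E n) :
    1 - ‖x + v‖ ^ 2 ≤ (1 - ‖x‖ ^ 2) * (1 + √(sqn L x v)) := by
  have hw := one_sub_normSq_pos hx.2
  have h : (2 * inner ℝ x v / (1 - ‖x‖ ^ 2)) ^ 2 ≤ sqn L x v := by
    induction L with
    | nil =>
      simp only [sqn, hessForm, add_apply, smul_apply,
        ContinuousLinearMap.id_apply, ContinuousLinearMap.smulRight_apply, innerSL_apply_apply,
        inner_add_left, real_inner_smul_left, real_inner_self_eq_norm_sq]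
      have : 0 ≤ 2 / (1 - ‖x‖ ^ 2) * ‖v‖ ^ 2 := by positivity
      have e : (2 * inner ℝ x v / (1 - ‖x‖ ^ 2)) ^ 2 =
        4 / (1 - ‖x‖ ^ 2) ^ 2 * (inner ℝ x v * inner ℝ x v) := by field_simp; ring
      linarith
    | cons G L ih =>
      rw [dom_cons] at hx
      rw [sqn_cons]
      linarith [ih hx.2, sq_nonneg (inner ℝ G.a v / G.dist x)]
  have h2 := Real.abs_le_sqrt h
  rw [abs_div, abs_of_pos hw, div_le_iff₀ hw] at h2
  rw [norm_add_sq_real]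
  nlinarith [neg_abs_le (2 * inner ℝ x v), sq_nonneg ‖v‖]

/-! ### Newton's method -/

/-- Follows from s ≤ sinh s at s = log(1 + y), where sinh is rational in y. -/
lemma sq_div_le_sub_log {y : ℝ} (hy : 0 ≤ y) : y ^ 2 / (2 * (1 + y)) ≤ y - Real.log (1 + y) := by
  have h1 : 0 < 1 + y := by linarith
  have h2 := Real.self_le_sinh_iff.2 (Real.log_nonneg (by linarith : (1 : ℝ) ≤ 1 + y))
  rw [Real.sinh_log h1] at h2
  have e : y ^ 2 / (2 * (1 + y)) = y - (1 + y - (1 + y)⁻¹) / 2 := by field_simp; ring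
  linarith

lemma neg_sub_log_le {y : ℝ} (hy : 0 ≤ y) (hy1 : y < 1) :
    -y - Real.log (1 - y) ≤ y ^ 2 / (2 * (1 - y)) := by
  have h1 : 0 < 1 - y := by linarith
  have h2 := Real.self_le_sinh_iff.2 (Real.log_nonneg ((one_le_inv₀ h1).2 (by linarith)))
  rw [Real.sinh_log (inv_pos.2 h1), Real.log_inv, inv_inv] at h2
  have e : y ^ 2 / (2 * (1 - y)) = -y + ((1 - y)⁻¹ - (1 - y)) / 2 := by field_simp; ring
  linarith

/-- Both kinds of step have local norm below 1, so `F_upper` applies. A damped step gains λ - log(1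
+ λ) ≥ 1/50 because λ ≥ 2 - √3. A full step gains λ² + λ + log(1 - λ) ≥ λ²/4 because λ < 2 - √3 <
1/3. -/
lemma newtonStep_spec {L : List (Cut n)} {x : E n} (hx : x ∈ dom L) :
    newtonStep L x ∈ dom L ∧
      F L (newtonStep L x) ≤ F L x - min (1 / 50) (lam L x ^ 2 / 4) := by
  have hl := lam_nonneg L x
  have hl2 := lam_sq hx
  obtain ⟨s, hs0, hs, hstep⟩ : ∃ s : ℝ, 0 ≤ s ∧
      ((2 - √3 ≤ lam L x ∧ s = (1 + lam L x)⁻¹) ∨ (lam L x < 2 - √3 ∧ s = 1)) ∧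
      newtonStep L x = x + (-s) • hessInv L x (gradForm L x) := by
    rcases le_or_gt (2 - √3) (lam L x) with h | h
    · exact ⟨(1 + lam L x)⁻¹, by positivity, Or.inl ⟨h, rfl⟩, by
        rw [newtonStep, if_pos h, grad_eq hx, neg_smul, sub_eq_add_neg]⟩
    · exact ⟨1, zero_le_one, Or.inr ⟨h, rfl⟩, by
        rw [newtonStep, if_neg (not_le.2 h), grad_eq hx, neg_smul, sub_eq_add_neg]⟩
  set v := (-s) • hessInv L x (gradForm L x) with hv
  have hq : sqn L x v = (s * lam L x) ^ 2 := by
    rw [hv, sqn_smul, sqn_hessInv hx, ← hl2]; ring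
  have hsq : √(sqn L x v) = s * lam L x := by rw [hq, Real.sqrt_sq (by positivity)]
  have hin : inner ℝ (gradForm L x) v = -(s * lam L x ^ 2) := by
    rw [hv, inner_smul_right, ← hl2]; ring
  have h3 : (1.732 : ℝ) ≤ √3 := Real.le_sqrt_of_sq_le (by norm_num)
  have h3' : √3 ≤ (1.74 : ℝ) := Real.sqrt_le_iff.2 ⟨by norm_num, by norm_num⟩
  have hlt : s * lam L x < 1 := by
    rcases hs with ⟨_, rfl⟩ | ⟨h, rfl⟩
    · rw [inv_mul_lt_iff₀ (by positivity)]; linarith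
    · linarith
  have hlt2 : sqn L x v < 1 := by
    rw [hq]; have : 0 ≤ s * lam L x := by positivity
    nlinarith
  have hF := F_upper hx hlt2
  rw [hsq, hin] at hF
  rw [hstep]
  refine ⟨add_mem_dom hx hlt2, hF.trans ?_⟩
  rcases hs with ⟨h, rfl⟩ | ⟨h, rfl⟩
  · refine le_trans ?_ (sub_le_sub_left (min_le_left _ _) _)
    have hp : 0 < 1 + lam L x := by positivity
    have e1 : 1 - (1 + lam L x)⁻¹ * lam L x = (1 + lam L x)⁻¹ := by field_simp; ring
    have e2 : (1 + lam L x)⁻¹ * lam L x ^ 2 + (1 + lam L x)⁻¹ * lam L x = lam L x := by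
      field_simp; ring
    rw [e1, Real.log_inv]
    have h4 := sq_div_le_sub_log hl
    have h5 : (1 : ℝ) / 50 ≤ lam L x ^ 2 / (2 * (1 + lam L x)) := by
      rw [div_le_div_iff₀ (by norm_num) (by positivity)]
      nlinarith
    linarith
  · refine le_trans ?_ (sub_le_sub_left (min_le_right _ _) _)
    have h4 := neg_sub_log_le hl (by linarith)
    have h5 : lam L x ^ 2 / (2 * (1 - lam L x)) ≤ 3 / 4 * lam L x ^ 2 := by
      rw [div_le_iff₀ (by linarith)]
      nlinarith [sq_nonneg (lam L x)]
    rw [one_mul, one_mul]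
    linarith

lemma newton_iterate_mem {L : List (Cut n)} {x : E n} (hx : x ∈ dom L) (k : ℕ) :
    (newtonStep L)^[k] x ∈ dom L := by
  induction k with
  | zero => exact hx
  | succ k ih => rw [Function.iterate_succ_apply']; exact (newtonStep_spec ih).1

lemma Recentres.mem_dom {L : List (Cut n)} {d : ℝ} {z z' : E n} (h : Recentres L d z z')
    (hz : z ∈ dom L) : z' ∈ dom L := by
  obtain ⟨k, rfl, -⟩ := h
  exact newton_iterate_mem hz k

lemma Recentres.centred {L : List (Cut n)} {d : ℝ} {z z' : E n} (h : Recentres L d z z') :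
    Centred L d z' := by
  obtain ⟨k, -, h, -⟩ := h
  exact h

lemma exists_le_F (L : List (Cut n)) : ∃ B : ℝ, ∀ x ∈ dom L, B ≤ F L x := by
  induction L with
  | nil =>
    refine ⟨0, fun x hx => ?_⟩
    rw [dom_nil] at hx
    have h := Real.log_nonpos (one_sub_normSq_pos hx).le (by nlinarith [norm_nonneg x])
    simp [F]; linarith
  | cons H L ih =>
    obtain ⟨B, hB⟩ := ih
    refine ⟨B - (‖H.a‖ + |H.b|), fun x hx => ?_⟩
    rw [dom_cons] at hx
    have h1 := hB x hx.2
    have h2 := Real.log_le_sub_one_of_pos (show 0 < H.dist x from hx.1)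
    have h3 := real_inner_le_norm H.a x
    have h4 : ‖H.a‖ * ‖x‖ ≤ ‖H.a‖ := mul_le_of_le_one_right (norm_nonneg _) hx.2.2.le
    have h5 := neg_abs_le H.b
    rw [F_cons]
    simp only [Cut.dist] at h2 ⊢
    linarith

lemma q_zero : q 0 = 0 := by simp [q]

lemma exists_q_lt {c : ℝ} (hc : 0 < c) : ∃ t > 0, ∀ l, 0 ≤ l → l < t → q l < c := by
  have hcont : ContinuousAt q 0 := by
    unfold q
    refine ContinuousAt.sub continuousAt_const (ContinuousAt.rpow_const (by fun_prop) ?_)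
    right; norm_num
  have h := Metric.continuousAt_iff.1 hcont c hc
  obtain ⟨t, ht, h⟩ := h
  refine ⟨t, ht, fun l hl hlt => ?_⟩
  have := h (x := l) (by rw [Real.dist_eq, sub_zero, abs_of_nonneg hl]; exact hlt)
  rw [q_zero, Real.dist_eq, sub_zero] at this
  exact (abs_lt.1 this).2

/-- The Newton loop terminates as soon as one of the cuts passes through the origin. -/
lemma exists_recentres {H : Cut n} {T : List (Cut n)} (ha : ‖H.a‖ = 1) (hb : H.b = 0)
    {d : ℝ} (hd : 0 < d) {z : E n} (hz : z ∈ dom (H :: T)) :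
    ∃ z', Recentres (H :: T) d z z' := by
  set L := H :: T
  have hmem := newton_iterate_mem hz
  have hex : ∃ k, Centred L d ((newtonStep L)^[k] z) := by
    by_contra! hno
    obtain ⟨B, hB⟩ := exists_le_F T
    have hanti : ∀ k, F L ((newtonStep L)^[k] z) ≤ F L z := by
      intro k
      induction k with
      | zero => exact le_rfl
      | succ k ih =>
        rw [Function.iterate_succ_apply']
        have := (newtonStep_spec (hmem k)).2
        have h0 : 0 ≤ min (1 / 50) (lam L ((newtonStep L)^[k] z) ^ 2 / 4) := by positivity
        linarith
    -- F does not increase and its other terms are bounded below, so the distance to the first cut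
    -- stays at least η. That cut passes through 0 with unit normal, so ‖x‖ ≥ η too and the test
    -- threshold cannot shrink to 0. Failing the test forever would then lower F by a fixed amount
    -- each time, against its lower bound.
    set η := Real.exp (B - F L z)
    have hη : ∀ k, η ≤ ‖(newtonStep L)^[k] z‖ := by
      intro k
      have h1 := hmem k
      rw [dom_cons] at h1
      have h2 := hB _ h1.2
      have h3 := hanti k
      rw [F_cons] at h3
      have h4 : 0 < H.dist ((newtonStep L)^[k] z) := h1.1
      have h5 : η ≤ H.dist ((newtonStep L)^[k] z) := by
        rw [← Real.exp_log h4]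
        exact Real.exp_le_exp.2 (by linarith)
      have h6 := real_inner_le_norm H.a ((newtonStep L)^[k] z)
      rw [ha, one_mul] at h6
      rw [Cut.dist, hb] at h5
      linarith
    have hη0 : 0 < η := Real.exp_pos _
    obtain ⟨t, ht, htq⟩ := exists_q_lt (c := d / (1 + d) * (η / √2)) (by positivity)
    have hρ : 0 < ρ₀ := by norm_num [ρ₀]
    have hlam : ∀ k, min t ρ₀ ≤ lam L ((newtonStep L)^[k] z) := by
      intro k
      by_contra! hlt
      refine hno k ⟨hlt.trans_le (min_le_right _ _), ?_⟩
      refine (htq _ (lam_nonneg _ _) (hlt.trans_le (min_le_left _ _))).trans_le ?_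
      have := hη k
      gcongr
    set τ := min t ρ₀
    have hτ : 0 < τ := lt_min ht hρ
    set m := min (1 / 50) (τ ^ 2 / 4)
    have hm : 0 < m := by positivity
    have hdec : ∀ k : ℕ, F L ((newtonStep L)^[k] z) ≤ F L z - k * m := by
      intro k
      induction k with
      | zero => simp
      | succ k ih =>
        rw [Function.iterate_succ_apply']
        have h1 := (newtonStep_spec (hmem k)).2
        have h2 : m ≤ min (1 / 50) (lam L ((newtonStep L)^[k] z) ^ 2 / 4) := by
          have := hlam k
          simp only [m]
          gcongr
        push_cast
        linarith
    obtain ⟨B', hB'⟩ := exists_le_F L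
    obtain ⟨k, hk⟩ := exists_nat_gt ((F L z - B') / m)
    rw [div_lt_iff₀ hm] at hk
    linarith [hdec k, hB' _ (hmem k)]
  classical
  exact ⟨_, Nat.find hex, rfl, Nat.find_spec hex, fun i hi => Nat.find_min hex hi⟩

/-! ### The analytic centre -/

/-- After cubing this is (1 - 3λ)(1 - λ)³ ≤ (1 - 2λ)³. It converts the distance bound λ/(1 - λ) to
the exact centre into the quantity tested by the algorithm. -/
lemma div_one_sub_le_q {l : ℝ} (h0 : 0 ≤ l) (h1 : l < ρ₀) : l / (1 - l) ≤ q l := by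
  norm_num [ρ₀] at h1
  have h2 : (0 : ℝ) < 1 - l := by linarith
  have h3 : (0 : ℝ) ≤ (1 - 2 * l) / (1 - l) := div_nonneg (by linarith) h2.le
  have h4 : (1 - 3 * l) ^ (1 / 3 : ℝ) ≤ (1 - 2 * l) / (1 - l) := by
    have : (1 - 2 * l) / (1 - l) = (((1 - 2 * l) / (1 - l)) ^ (3 : ℝ)) ^ (1 / 3 : ℝ) := by
      rw [← Real.rpow_mul h3]; norm_num
    rw [this]
    refine Real.rpow_le_rpow (by linarith) ?_ (by norm_num)
    have e3 : ∀ y : ℝ, y ^ (3 : ℝ) = y ^ 3 := fun y => by exact_mod_cast Real.rpow_natCast y 3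
    rw [e3, div_pow, le_div_iff₀ (by positivity)]
    nlinarith [pow_nonneg h0 3, pow_nonneg h0 4]
  have e : l / (1 - l) = 1 - (1 - 2 * l) / (1 - l) := by field_simp; ring
  rw [e, q]
  linarith

lemma q_le_ζ₀ {l : ℝ} (h1 : l < ρ₀) : q l ≤ ζ₀ := by
  have h2 : ρ₀ = 0.001 := rfl
  rw [ζ₀, q, q]
  have : (1 - 3 * ρ₀) ^ (1 / 3 : ℝ) ≤ (1 - 3 * l) ^ (1 / 3 : ℝ) :=
    Real.rpow_le_rpow (by rw [h2]; norm_num) (by linarith) (by norm_num)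
  linarith

lemma ζ₀_le : ζ₀ ≤ 0.01 := by
  have h : (0.99 : ℝ) ≤ (1 - 3 * ρ₀) ^ (1 / 3 : ℝ) := by
    have : (0.99 : ℝ) = ((0.99 : ℝ) ^ (3 : ℝ)) ^ (1 / 3 : ℝ) := by
      rw [← Real.rpow_mul (by norm_num)]; norm_num
    rw [this]
    refine Real.rpow_le_rpow (by positivity) ?_ (by norm_num)
    norm_num [ρ₀]
  rw [ζ₀, q]; linarith

/-- Near an approximate centre there is an exact one. -/
lemma exists_centre {L : List (Cut n)} {z : E n} (hz : z ∈ dom L) (hl : lam L z < ρ₀) :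
    ∃ v : E n, z + v ∈ dom L ∧ gradForm L (z + v) = 0 ∧ √(sqn L z v) ≤ q (lam L z) := by
  have hl0 := lam_nonneg L z
  have hl' : lam L z < 0.001 := hl
  set B : Set (E n) := {v | sqn L z v ≤ 1 / 4}
  have hcont : Continuous (sqn L z) := by unfold sqn; fun_prop
  have hBc : IsCompact B := by
    refine Metric.isCompact_of_isClosed_isBounded (isClosed_le hcont continuous_const) ?_
    refine (Metric.isBounded_closedBall (x := (0 : E n)) (r := 1)).subset fun v hv => ?_
    have h1 := two_normSq_le hz v
    have h2 : sqn L z v ≤ 1 / 4 := hv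
    rw [sqn] at h2
    rw [mem_closedBall_zero_iff]
    nlinarith [norm_nonneg v]
  have hB0 : (0 : E n) ∈ B := by simp [B, sqn]
  have hBd : ∀ v ∈ B, z + v ∈ dom L := fun v hv =>
    add_mem_dom hz (lt_of_le_of_lt (show sqn L z v ≤ 1 / 4 from hv) (by norm_num))
  obtain ⟨v, hvB, hmin⟩ := hBc.exists_isMinOn ⟨0, hB0⟩
    (f := fun v => F L (z + v)) ((continuousOn_F L).comp (by fun_prop) hBd)
  have hv := hBd v hvB
  have hle : F L (z + v) ≤ F L z := by simpa using hmin hB0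
  have hlow := F_lower hz hv
  have habs := (abs_le.1 (abs_inner_gradForm_le hz v)).1
  -- On the boundary t = 1/2 the growth t - log(1 + t) ≥ 1/12 beats the linear term, which is at
  -- most 0.0005. The minimiser is thus interior, hence stationary.
  have hlt : sqn L z v < 1 / 4 := by
    refine lt_of_le_of_ne hvB fun heq => ?_
    have hs : √(sqn L z v) = 1 / 2 := by
      rw [heq, show (1 / 4 : ℝ) = (1 / 2) ^ 2 by norm_num, Real.sqrt_sq (by norm_num)]
    have h5 := sq_div_le_sub_log (y := 1 / 2) (by norm_num)
    rw [hs] at hlow habs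
    norm_num at h5 hlow habs
    linarith
  have hloc : IsLocalMin (fun v => F L (z + v)) v := by
    filter_upwards [(isOpen_lt hcont continuous_const).mem_nhds hlt] with w hw
    exact hmin (show sqn L z w ≤ 1 / 4 from le_of_lt hw)
  have hder : HasFDerivAt (fun v => F L (z + v)) (innerSL ℝ (gradForm L (z + v))) v := by
    have := (hasFDerivAt_F hv).comp v ((hasFDerivAt_id v).const_add z)
    simpa [Function.comp_def] using this
  have h0 := hloc.hasFDerivAt_eq_zero hder
  have hg : gradForm L (z + v) = 0 := by
    have := congrArg (fun f => f (gradForm L (z + v))) h0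
    simpa using this
  refine ⟨v, hv, hg, (le_trans ?_ (div_one_sub_le_q hl0 hl))⟩
  -- Monotonicity gives t²/(1 + t) ≤ λt, that is t ≤ λ/(1 - λ).
  have hmon := inner_gradForm_sub hz hv
  rw [hg, inner_zero_left] at hmon
  have hs := Real.sq_sqrt (sqn_nonneg hz v)
  have ht := Real.sqrt_nonneg (sqn L z v)
  set t := √(sqn L z v)
  rw [← hs, div_le_iff₀ (by positivity)] at hmon
  rw [le_div_iff₀ (by linarith)]
  rcases ht.eq_or_lt with h | h
  · rw [← h]; linarith
  · have : t * t ≤ t * (lam L z * (1 + t)) := by nlinarith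
    have := le_of_mul_le_mul_left this h
    linarith

lemma inner_gradForm (L : List (Cut n)) (x m : E n) :
    inner ℝ (gradForm L x) m =
      2 / (1 - ‖x‖ ^ 2) * inner ℝ x m - (L.map fun H => inner ℝ H.a m / H.dist x).sum := by
  induction L with
  | nil => simp [gradForm, inner_smul_left]
  | cons H L ih =>
    rw [gradForm, inner_sub_left, ih, real_inner_smul_left, List.map_cons, List.sum_cons]
    ring

section Centre

variable {L : List (Cut n)} {ω : E n}

lemma inner_centre (h0 : gradForm L ω = 0) (m : E n) :
    2 / (1 - ‖ω‖ ^ 2) * inner ℝ ω m = (L.map fun H => inner ℝ H.a m / H.dist ω).sum := by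
  have := inner_gradForm L ω m
  rw [h0, inner_zero_left] at this
  linarith

/-- Stationarity makes ω a positive multiple of Σ aᵢ/distᵢ. This is why the direction of the centre
is a good test vector. -/
lemma inner_centre_nonneg (hω : ω ∈ dom L) (h0 : gradForm L ω = 0) {m : E n}
    (hm : ∀ H ∈ L, 0 ≤ inner ℝ H.a m) : 0 ≤ inner ℝ ω m := by
  have h1 := inner_centre h0 m
  have h2 : 0 ≤ (L.map fun H => inner ℝ H.a m / H.dist ω).sum := by
    refine List.sum_nonneg fun y hy => ?_
    obtain ⟨H, hH, rfl⟩ := List.mem_map.1 hy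
    exact div_nonneg (hm H hH) (hω.1 H hH).le
  rw [← h1] at h2
  exact nonneg_of_mul_nonneg_right h2 (div_pos two_pos (one_sub_normSq_pos hω.2))

/-- From the analytic centre, no distance can be multiplied by more than `h + 1`. -/
lemma dist_le_mul_centre (hω : ω ∈ dom L) (h0 : gradForm L ω = 0) {x : E n}
    (hx : ‖x‖ ≤ 1) (hxL : ∀ H ∈ L, 0 ≤ H.dist x) {H : Cut n} (hH : H ∈ L) :
    H.dist x ≤ (L.length + 1) * H.dist ω := by
  have hd := hω.1 H hH
  have h1 : H.dist x / H.dist ω ≤ (L.map fun G => G.dist x / G.dist ω).sum := by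
    refine List.single_le_sum (fun y hy => ?_) _ (List.mem_map_of_mem (f := fun G : Cut n =>
      G.dist x / G.dist ω) hH)
    obtain ⟨G, hG, rfl⟩ := List.mem_map.1 hy
    exact div_nonneg (hxL G hG) (hω.1 G hG).le
  -- Each ratio is 1 plus a slope. By stationarity the slopes add up to the ball term, which is at
  -- most 1 for ‖x‖ ≤ 1.
  have h2 : ∀ M : List (Cut n), (∀ G ∈ M, 0 < G.dist ω) →
      (M.map fun G => G.dist x / G.dist ω).sum =
        M.length + (M.map fun G => inner ℝ G.a (x - ω) / G.dist ω).sum := by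
    intro M hM
    induction M with
    | nil => simp
    | cons G M ih =>
      have hG := hM G List.mem_cons_self
      rw [List.map_cons, List.sum_cons, ih fun G' h => hM G' (List.mem_cons_of_mem _ h),
        List.map_cons, List.sum_cons, List.length_cons]
      have e : G.dist x / G.dist ω = 1 + inner ℝ G.a (x - ω) / G.dist ω := by
        have : G.dist x = G.dist ω + inner ℝ G.a (x - ω) := by
          rw [← dist_add]; simp
        rw [this]; field_simp
      rw [e]; push_cast; ring
  rw [h2 L hω.1, ← inner_centre h0] at h1
  have hw := one_sub_normSq_pos hω.2
  have h3 : 2 / (1 - ‖ω‖ ^ 2) * inner ℝ ω (x - ω) ≤ 1 := by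
    rw [div_mul_eq_mul_div, div_le_one hw, inner_sub_right, real_inner_self_eq_norm_sq]
    have := real_inner_le_norm ω x
    have : ‖ω‖ * ‖x‖ ≤ ‖ω‖ := mul_le_of_le_one_right (norm_nonneg _) hx
    nlinarith [sq_nonneg (1 - ‖ω‖)]
  rw [div_le_iff₀ hd] at h1
  nlinarith

/-- Stationarity tested against ω itself: b ≤ 0 makes every term aᵀω/dist at most 1. -/
lemma one_sub_normSq_centre (hω : ω ∈ dom L) (h0 : gradForm L ω = 0)
    (hb : ∀ H ∈ L, H.b ≤ 0) : 2 / (L.length + 2) ≤ 1 - ‖ω‖ ^ 2 := by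
  have hw := one_sub_normSq_pos hω.2
  have h1 : (L.map fun H => inner ℝ H.a ω / H.dist ω).sum ≤ L.length := by
    have := List.sum_le_card_nsmul (L.map fun H => inner ℝ H.a ω / H.dist ω) 1 (by
      intro y hy
      obtain ⟨G, hG, rfl⟩ := List.mem_map.1 hy
      rw [div_le_one (hω.1 G hG)]
      have := hb G hG
      rw [Cut.dist]; linarith)
    simpa using this
  rw [← inner_centre h0, real_inner_self_eq_norm_sq, div_mul_eq_mul_div, div_le_iff₀ hw] at h1
  rw [div_le_iff₀ (by positivity)]
  linarith

end Centre

/-! ### The effect of one iteration on the barrier -/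

lemma log_le_of_pos {x c : ℝ} (hx : 0 < x) (hc : 0 < c) :
    Real.log x ≤ Real.log c + (x / c - 1) := by
  have := Real.log_le_sub_one_of_pos (div_pos hx hc)
  rw [Real.log_div hx.ne' hc.ne'] at this
  linarith

lemma log_le_half_sub_inv {x : ℝ} (hx : 1 ≤ x) : Real.log x ≤ (x - x⁻¹) / 2 := by
  have h2 := Real.self_le_sinh_iff.2 (Real.log_nonneg hx)
  rwa [Real.sinh_log (by linarith)] at h2

/-- The change is at least t/2 - log(1 + t), minimal at t = 1 with value 1/2 - log 2 > -0.2. -/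
lemma F_drop {L : List (Cut n)} {x v : E n} (hx : x ∈ dom L) (hxv : x + v ∈ dom L)
    (h : -(√(sqn L x v) / 2) ≤ inner ℝ (gradForm L x) v) :
    F L x - 0.2 ≤ F L (x + v) := by
  have h1 := F_lower hx hxv
  have h2 := log_le_of_pos (x := 1 + √(sqn L x v)) (c := 2) (by positivity) two_pos
  have h3 := Real.log_two_lt_d9
  linarith

/-- An approximate centre almost minimises the barrier. -/
lemma F_near_opt {L : List (Cut n)} {z x : E n} (hz : z ∈ dom L) (hl : lam L z < ρ₀)
    (hx : x ∈ dom L) : F L z ≤ F L x + 1 / 100000 := by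
  obtain ⟨v, rfl⟩ : ∃ v, x = z + v := ⟨x - z, by simp⟩
  have h1 := F_lower hz hx
  have h2 := (abs_le.1 (abs_inner_gradForm_le hz v)).1
  have ht := Real.sqrt_nonneg (sqn L z v)
  set t := √(sqn L z v)
  -- Tangent to log at the minimiser of 0.999t - log(1 + t).
  have h3 := log_le_of_pos (x := 1 + t) (c := (0.999)⁻¹) (by positivity) (by norm_num)
  have h4 := log_le_half_sub_inv (x := (0.999)⁻¹) (by norm_num)
  norm_num at h3 h4
  have h5 : lam L z * t ≤ 0.001 * t := by
    have : lam L z < 0.001 := hl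
    gcongr
  norm_num at h5
  linarith

/-- Dropping the cut adds a/dist to an almost zero gradient. In the local norm without the cut, σ <
0.08 gives |aᵀv|/dist ≤ 0.3t, so `F_drop` applies. -/
lemma F_discard {H : Cut n} {L : List (Cut n)} {z x : E n} (hz : z ∈ dom (H :: L))
    (hl : lam (H :: L) z < ρ₀) (hs : sig (H :: L) H z < σ₀) (hx : x ∈ dom L) :
    F (H :: L) z + Real.log (H.dist z) - 0.2 ≤ F L x := by
  have hd : 0 < H.dist z := hz.1 H List.mem_cons_self
  have hzL : z ∈ dom L := by rw [dom_cons] at hz; exact hz.2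
  obtain ⟨v, rfl⟩ : ∃ v, x = z + v := ⟨x - z, by simp⟩
  rw [F_cons]
  have key : -(√(sqn L z v) / 2) ≤ inner ℝ (gradForm L z) v := by
    have h1 := (abs_le.1 (abs_inner_gradForm_le hz v)).1
    rw [gradForm, inner_sub_left, real_inner_smul_left, sqn_cons, inv_mul_eq_div] at h1
    have h2 := sq_inner_le hz H.a v
    rw [sqn_cons] at h2
    have h4 : σ₀ = 0.08 := rfl
    have hq := Real.sq_sqrt (sqn_nonneg hzL v)
    have hq0 := Real.sqrt_nonneg (sqn L z v)
    set t := √(sqn L z v)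
    rw [← hq] at h1 h2
    set y := inner ℝ H.a v / H.dist z with hy
    have hay : inner ℝ H.a v = y * H.dist z := by rw [hy]; field_simp
    rw [sig, div_lt_iff₀ (by positivity), h4] at hs
    have h3 : y ^ 2 ≤ 0.08 * (t ^ 2 + y ^ 2) := by
      rw [hay] at h2
      have : (y * H.dist z) ^ 2 ≤ 0.08 * (H.dist z) ^ 2 * (t ^ 2 + y ^ 2) :=
        h2.trans (by gcongr)
      have hd2 : 0 < (H.dist z) ^ 2 := by positivity
      refine le_of_mul_le_mul_right ?_ hd2
      linarith
    have h5 : -(0.3 * t) ≤ y := neg_le_of_sq_le (by positivity) (by nlinarith)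
    have h6 : √(t ^ 2 + y ^ 2) ≤ 2 * t := Real.sqrt_le_iff.2 ⟨by positivity, by nlinarith⟩
    have h7 : lam (H :: L) z * √(t ^ 2 + y ^ 2) ≤ 0.001 * (2 * t) := by
      have : lam (H :: L) z < 0.001 := hl
      have := lam_nonneg (H :: L) z
      gcongr
    linarith
  have := F_drop hzL hx key
  linarith

/-- A test step of local norm 0.2 along ∇²F⁻¹a lengthens the new distance to 1.05d and lowers the
new barrier by more than 0.02. The near-optimal z' does as well, while a displacement t multiplies
the distance by at most 1 + t/4. This forces t ≥ 0.09, which raises the old barrier. Conversely t >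
1 would make the new barrier exceed its value at z, whence the factor 5/4. -/
lemma F_add {G : Cut n} {L : List (Cut n)} {z z' : E n} (hz : z ∈ dom L)
    (hl : lam L z < ρ₀) (hd : 0 < G.dist z)
    (hγ : inner ℝ G.a (hessInv L z G.a) / (G.dist z) ^ 2 = γ₀ ^ 2)
    (hz' : z' ∈ dom (G :: L)) (hl' : lam (G :: L) z' < ρ₀) :
    F L z + 0.003 ≤ F L z' ∧ G.dist z' ≤ 5 / 4 * G.dist z := by
  have hl1 : lam L z < 0.001 := hl
  have hl0 := lam_nonneg L z
  set d := G.dist z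
  have hau : inner ℝ G.a (hessInv L z G.a) = d ^ 2 / 16 := by
    rw [div_eq_iff (by positivity)] at hγ
    rw [hγ, γ₀]; ring
  have hd' : 0 < G.dist z' := hz'.1 G List.mem_cons_self
  have hzG : z ∈ dom (G :: L) := by rw [dom_cons]; exact ⟨hd, hz⟩
  have hz'L : z' ∈ dom L := by rw [dom_cons] at hz'; exact hz'.2
  -- the test point
  set v := (0.8 / d) • hessInv L z G.a with hv
  have hsv : sqn L z v = 0.2 ^ 2 := by
    rw [hv, sqn_smul, sqn_hessInv hz, hau]; field_simp; norm_num
  have hsv' : √(sqn L z v) = 0.2 := by rw [hsv, Real.sqrt_sq (by norm_num)]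
  have hv1 : sqn L z v < 1 := by rw [hsv]; norm_num
  have hav : G.dist (z + v) = 1.05 * d := by
    rw [dist_add, hv, inner_smul_right, hau, show G.dist z = d from rfl]
    field_simp; norm_num
  have hzv : z + v ∈ dom (G :: L) := by
    rw [dom_cons]
    exact ⟨by rw [Set.mem_ofPred_eq, hav]; positivity, add_mem_dom hz hv1⟩
  have hup := F_upper hz hv1
  have habs := (abs_le.1 (abs_inner_gradForm_le hz v)).2
  have hopt := F_near_opt hz' hl' hzv
  have hopt0 := F_near_opt hz' hl' hzG
  rw [F_cons, F_cons] at hopt hopt0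
  rw [hav, Real.log_mul (by norm_num) hd.ne'] at hopt
  rw [hsv'] at hup habs
  have hlog : -(0.1753 : ℝ) ≤ Real.log (1 - 0.2) + Real.log 1.05 := by
    rw [← Real.log_mul (by norm_num) (by norm_num)]
    have := log_le_half_sub_inv (x := ((1 - 0.2) * 1.05)⁻¹) (by norm_num)
    rw [Real.log_inv] at this
    norm_num at this ⊢
    linarith
  -- the displacement
  obtain ⟨w, rfl⟩ : ∃ w, z' = z + w := ⟨z' - z, by simp⟩
  have hlow := F_lower hz hz'L
  have habs2 := (abs_le.1 (abs_inner_gradForm_le hz w)).1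
  have hcs := sq_inner_le hz G.a w
  have hsq := Real.sq_sqrt (sqn_nonneg hz w)
  have ht := Real.sqrt_nonneg (sqn L z w)
  set t := √(sqn L z w)
  rw [← hsq, hau] at hcs
  have haw : inner ℝ G.a w ≤ d * t / 4 :=
    le_of_sq_le_sq (hcs.trans (le_of_eq (by ring))) (by positivity)
  have hdt : G.dist (z + w) ≤ d * (1 + t / 4) := by rw [dist_add]; linarith
  have hlogd : Real.log (G.dist (z + w)) ≤ Real.log d + Real.log (1 + t / 4) := by
    rw [← Real.log_mul hd.ne' (by positivity)]
    exact Real.log_le_log hd' hdt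
  have hlt : lam L z * t ≤ 0.001 * t := by gcongr
  have hquad := sq_div_le_sub_log ht
  constructor
  · have h1 := Real.log_le_sub_one_of_pos (show 0 < 1 + t / 4 by positivity)
    have h2 : 0 ≤ t ^ 2 / (2 * (1 + t)) := by positivity
    have h3 : 0.09 ≤ t := by
      norm_num at hlt habs hup hlog hopt ⊢
      linarith
    have h4 : 0.003 + 0.001 * t ≤ t ^ 2 / (2 * (1 + t)) := by
      rw [le_div_iff₀ (by positivity)]
      nlinarith
    linarith
  · have h3 : t ≤ 1 := by
      by_contra! h
      have h1 := log_le_of_pos (x := 1 + t / 4) (c := 1.25) (by positivity) (by norm_num)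
      have h2 := log_le_of_pos (x := 1 + t) (c := 2) (by positivity) (by norm_num)
      have h4 := log_le_half_sub_inv (x := 1.25) (by norm_num)
      have h5 := Real.log_two_lt_d9
      norm_num at h1 h2 h4 h5 hlt hopt0
      linarith
    nlinarith

/-! ### Invariance under permutation of the cuts -/

lemma F_perm {L L' : List (Cut n)} (h : L.Perm L') : F L = F L' := by
  funext x
  simp only [F, (h.map _).sum_eq]

lemma dom_perm {L L' : List (Cut n)} (h : L.Perm L') : dom L = dom L' := by
  ext x; simp only [dom, h.mem_iff]

/-- The Newton loop sees the cuts only through F, which ignores order and κ. The cut being changed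
may therefore be moved to the head of the list. -/
lemma grad_congr {L L' : List (Cut n)} (h : F L = F L') : grad L = grad L' := by
  funext x; rw [grad, grad, h]

lemma hessInv_congr {L L' : List (Cut n)} (h : F L = F L') : hessInv L = hessInv L' := by
  funext x v; rw [hessInv, hessInv, hess, hess, grad_congr h]

lemma lam_congr {L L' : List (Cut n)} (h : F L = F L') : lam L = lam L' := by
  funext x; rw [lam, lam, grad_congr h, hessInv_congr h]

lemma sig_congr {L L' : List (Cut n)} (h : F L = F L') : sig L = sig L' := by
  funext G x; rw [sig, sig, hessInv_congr h]

lemma Centred_congr {L L' : List (Cut n)} (h : F L = F L') : Centred L = Centred L' := by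
  funext d x; rw [Centred, Centred, lam_congr h]

lemma Recentres_congr {L L' : List (Cut n)} (h : F L = F L') : Recentres L = Recentres L' := by
  have e : newtonStep L = newtonStep L' := by
    funext x; simp only [newtonStep, lam_congr h, hessInv_congr h, grad_congr h]
  funext d z z'
  simp only [Recentres, e, Centred_congr h]

/-! ### Gram determinants -/

/-- The Gram matrix of the normals, scaled by the reference distances. -/
def gram (S : Multiset (Cut n)) : Matrix (Fin n) (Fin n) ℝ :=
  (8 : ℝ) • (1 : Matrix (Fin n) (Fin n) ℝ) +
    (S.map fun H => (H.kappa ^ 2)⁻¹ • Matrix.vecMulVec H.a.ofLp H.a.ofLp).sum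

/-- The quadratic form of the Gram matrix. -/
def gramForm (S : Multiset (Cut n)) (w : E n) : ℝ :=
  8 * ‖w‖ ^ 2 + (S.map fun H => (inner ℝ H.a w / H.kappa) ^ 2).sum

lemma gram_cons (H : Cut n) (S : Multiset (Cut n)) :
    gram (H ::ₘ S) = gram S + (H.kappa ^ 2)⁻¹ • Matrix.vecMulVec H.a.ofLp H.a.ofLp := by
  simp only [gram, Multiset.map_cons, Multiset.sum_cons]; abel

lemma gramForm_cons (H : Cut n) (S : Multiset (Cut n)) (w : E n) :
    gramForm (H ::ₘ S) w = gramForm S w + (inner ℝ H.a w / H.kappa) ^ 2 := by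
  simp only [gramForm, Multiset.map_cons, Multiset.sum_cons]; ring

lemma gramForm_mono {S T : Multiset (Cut n)} (h : S ≤ T) (w : E n) :
    gramForm S w ≤ gramForm T w := by
  obtain ⟨U, rfl⟩ := Multiset.le_iff_exists_add.1 h
  rw [gramForm, gramForm, Multiset.map_add, Multiset.sum_add]
  have : 0 ≤ (U.map fun H => (inner ℝ H.a w / H.kappa) ^ 2).sum :=
    Multiset.sum_nonneg fun y hy => by
      obtain ⟨H, -, rfl⟩ := Multiset.mem_map.1 hy
      positivity
  linarith

lemma inner_eq_dotProduct (v w : E n) : inner ℝ v w = v.ofLp ⬝ᵥ w.ofLp := by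
  rw [EuclideanSpace.inner_eq_star_dotProduct, star_trivial, dotProduct_comm]

lemma dotProduct_gram (S : Multiset (Cut n)) (w : E n) :
    w.ofLp ⬝ᵥ (gram S).mulVec w.ofLp = gramForm S w := by
  induction S using Multiset.induction with
  | empty =>
    simp [gram, gramForm, Matrix.smul_mulVec, ← inner_eq_dotProduct]
  | cons H S ih =>
    rw [gram_cons, gramForm_cons, Matrix.add_mulVec, dotProduct_add, ih, Matrix.smul_mulVec,
      Matrix.vecMulVec_mulVec, inner_eq_dotProduct]
    simp only [dotProduct_smul, smul_eq_mul, op_smul_eq_smul]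
    rw [dotProduct_comm w.ofLp]
    ring

lemma gram_transpose (S : Multiset (Cut n)) : (gram S).transpose = gram S := by
  induction S using Multiset.induction with
  | empty => simp [gram]
  | cons H S ih => rw [gram_cons, Matrix.transpose_add, ih, Matrix.transpose_smul,
      Matrix.transpose_vecMulVec]

lemma gramForm_pos (S : Multiset (Cut n)) {w : E n} (hw : w ≠ 0) : 0 < gramForm S w := by
  have h := gramForm_mono (Multiset.zero_le S) w
  have : 0 < ‖w‖ := norm_pos_iff.2 hw
  refine lt_of_lt_of_le ?_ h
  simp only [gramForm, Multiset.map_zero, Multiset.sum_zero]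
  positivity

lemma gram_posDef (S : Multiset (Cut n)) : (gram S).PosDef := by
  refine Matrix.PosDef.of_dotProduct_mulVec_pos ?_ fun x hx => ?_
  · rw [Matrix.IsHermitian, Matrix.conjTranspose_eq_transpose_of_trivial, gram_transpose]
  · have := gramForm_pos S (w := WithLp.toLp 2 x) (by simpa using hx)
    rw [← dotProduct_gram] at this
    simpa using this

/-- The matrix determinant lemma gives the factor 1 + aᵀA⁻¹a/κ², and Cauchy–Schwarz bounds aᵀA⁻¹a
below by (aᵀw)²/wᵀAw for any w. -/
lemma det_gram_cons {G : Cut n} {S : Multiset (Cut n)} {c : ℝ} {w : E n} (hκ : 0 < G.kappa)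
    (hw : w ≠ 0) (h : c * G.kappa ^ 2 * gramForm S w ≤ (inner ℝ G.a w) ^ 2) :
    (1 + c) * (gram S).det ≤ (gram (G ::ₘ S)).det := by
  have hpos := (gram_posDef S).det_pos
  have hu : IsUnit (gram S).det := hpos.ne'.isUnit
  set A := gram S with hA
  set a := G.a.ofLp
  set u := A⁻¹.mulVec a with hu'
  have hAu : A.mulVec u = a := by
    rw [hu', Matrix.mulVec_mulVec, Matrix.mul_nonsing_inv _ hu, Matrix.one_mulVec]
  have hdet : (gram (G ::ₘ S)).det = A.det * (1 + (G.kappa ^ 2)⁻¹ * (a ⬝ᵥ u)) := by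
    have h1 := Matrix.det_add_replicateCol_mul_replicateRow (ι := Unit) hu
      ((G.kappa ^ 2)⁻¹ • a) a
    rw [gram_cons]
    have e1 : Matrix.replicateCol Unit ((G.kappa ^ 2)⁻¹ • a) * Matrix.replicateRow Unit a =
        (G.kappa ^ 2)⁻¹ • Matrix.vecMulVec a a := by
      ext i j; simp [Matrix.mul_apply, Matrix.vecMulVec_apply, mul_assoc]
    rw [← hA, ← e1, h1]
    congr 1
    rw [Matrix.det_unique]
    simp only [Matrix.add_apply, Matrix.one_apply_eq]
    rw [Matrix.mul_assoc, Matrix.replicateCol_smul, Matrix.mul_smul, Matrix.mul_smul,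
      Matrix.smul_apply, ← Matrix.replicateCol_mulVec, Matrix.replicateRow_mul_replicateCol_apply,
      smul_eq_mul]
  have hcs : (a ⬝ᵥ w.ofLp) ^ 2 ≤ (a ⬝ᵥ u) * gramForm S w := by
    have hsym : w.ofLp ⬝ᵥ A.mulVec u = u ⬝ᵥ A.mulVec w.ofLp := by
      rw [Matrix.dotProduct_mulVec, ← Matrix.mulVec_transpose, hA, gram_transpose,
        dotProduct_comm]
    have hgw : w.ofLp ⬝ᵥ A.mulVec w.ofLp = gramForm S w := dotProduct_gram S w
    have key : ∀ s : ℝ, 0 ≤ gramForm S w * (s * s) + (2 * (a ⬝ᵥ w.ofLp)) * s + a ⬝ᵥ u := by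
      intro s
      have h1 := (gram_posDef S).posSemidef.dotProduct_mulVec_nonneg (u + s • w.ofLp)
      rw [star_trivial, ← hA, Matrix.mulVec_add, Matrix.mulVec_smul, add_dotProduct,
        dotProduct_add, dotProduct_add, dotProduct_smul, smul_dotProduct, smul_dotProduct,
        dotProduct_smul, hgw, ← hsym, hAu, dotProduct_comm u,
        dotProduct_comm w.ofLp a] at h1
      simp only [smul_eq_mul] at h1
      linarith
    have h2 := discrim_le_zero key
    rw [discrim] at h2
    nlinarith
  have hg := gramForm_pos S hw
  rw [inner_eq_dotProduct] at h
  have h3 : c * G.kappa ^ 2 ≤ a ⬝ᵥ u := le_of_mul_le_mul_right (h.trans hcs) hg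
  have h4 : c ≤ (G.kappa ^ 2)⁻¹ * (a ⬝ᵥ u) := by
    rw [inv_mul_eq_div, le_div_iff₀ (by positivity)]; exact h3
  rw [hdet, mul_comm]
  gcongr

/-- Each eigenvalue is at most the trace. This is weaker than AM–GM by a factor nⁿ, which the size
of ν absorbs. -/
lemma det_le_trace_pow {A : Matrix (Fin n) (Fin n) ℝ} (hA : A.PosDef) :
    A.det ≤ A.trace ^ n := by
  rw [hA.isHermitian.det_eq_prod_eigenvalues, hA.isHermitian.trace_eq_sum_eigenvalues]
  simp only [RCLike.ofReal_real_eq_id, id]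
  have h := Finset.prod_le_prod (s := Finset.univ) (f := hA.isHermitian.eigenvalues)
    (g := fun _ => ∑ i, hA.isHermitian.eigenvalues i)
    (fun i _ => (hA.eigenvalues_pos i).le)
    (fun i _ => Finset.single_le_sum (f := hA.isHermitian.eigenvalues)
      (fun j _ => (hA.eigenvalues_pos j).le) (Finset.mem_univ i))
  simpa using h

lemma trace_gram_le {S : Multiset (Cut n)} {κ : ℝ} (hκ : 0 < κ)
    (hS : ∀ H ∈ S, ‖H.a‖ = 1 ∧ κ ≤ H.kappa) :
    (gram S).trace ≤ 8 * n + S.card * (κ ^ 2)⁻¹ := by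
  induction S using Multiset.induction with
  | empty => simp [gram, Matrix.trace_smul]
  | cons H S ih =>
    have h1 := ih fun G hG => hS G (Multiset.mem_cons_of_mem hG)
    obtain ⟨h2, h3⟩ := hS H (Multiset.mem_cons_self _ _)
    rw [gram_cons, Matrix.trace_add, Matrix.trace_smul, Matrix.trace_vecMulVec,
      ← inner_eq_dotProduct, real_inner_self_eq_norm_sq, h2, Multiset.card_cons]
    have h4 : (H.kappa ^ 2)⁻¹ ≤ (κ ^ 2)⁻¹ := by gcongr
    push_cast
    simp only [smul_eq_mul]
    linarith

/-- Every subfamily of `S` has a Gram determinant that is exponential in its size. -/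
def GramGood (S : Multiset (Cut n)) : Prop :=
  ∀ T ≤ S, (8 : ℝ) ^ n * 1.01 ^ T.card ≤ (gram T).det

lemma GramGood.mono {S T : Multiset (Cut n)} (h : GramGood T) (hST : S ≤ T) : GramGood S :=
  fun U hU => h U (hU.trans hST)

lemma gramGood_zero : GramGood (0 : Multiset (Cut n)) := by
  intro T hT
  rw [Multiset.le_zero.1 hT]
  simp [gram]

/-- The hypothesis passes to subfamilies because `gramForm` is monotone. Quantifying over
subfamilies is what makes the property survive discards. -/
lemma GramGood.cons {G : Cut n} {S : Multiset (Cut n)} (hS : GramGood S) (hκ : 0 < G.kappa)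
    {w : E n} (hw : w ≠ 0) (h : 0.01 * G.kappa ^ 2 * gramForm S w ≤ (inner ℝ G.a w) ^ 2) :
    GramGood (G ::ₘ S) := by
  classical
  intro T hT
  by_cases hG : G ∈ T
  · obtain ⟨U, rfl⟩ := Multiset.exists_cons_of_mem hG
    have hU : U ≤ S := (Multiset.cons_le_cons_iff G).1 hT
    have h1 := hS U hU
    have h2 : 0.01 * G.kappa ^ 2 * gramForm U w ≤ (inner ℝ G.a w) ^ 2 :=
      le_trans (by have := gramForm_mono hU w; gcongr) h
    have h3 := det_gram_cons hκ hw h2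
    rw [Multiset.card_cons, pow_succ]
    have h4 : (8 : ℝ) ^ n * 1.01 ^ U.card * 1.01 ≤ (gram U).det * 1.01 := by gcongr
    norm_num at h3 h4 ⊢
    linarith
  · exact hS T ((Multiset.le_cons_of_notMem hG).1 hT)

/-- dist ≤ 2κ makes each Gram term at most four times its Hessian term, and 8I is four times the
lower bound 2I. -/
lemma gramForm_filter_le {L : List (Cut n)} {z : E n} (hz : z ∈ dom L) (P : Cut n → Prop)
    [DecidablePred P] (hκ : ∀ H ∈ L, 0 < H.kappa)
    (hP : ∀ H ∈ L, P H → H.μ z ≤ 2) (w : E n) :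
    gramForm (Multiset.filter P (L : Multiset (Cut n))) w ≤ 4 * sqn L z w := by
  induction L with
  | nil =>
    have := two_normSq_le hz w
    simp only [gramForm, sqn, Multiset.coe_nil, Multiset.filter_zero, Multiset.map_zero,
      Multiset.sum_zero]
    linarith
  | cons H L ih =>
    rw [dom_cons] at hz
    have h1 := ih hz.2 (fun G hG => hκ G (List.mem_cons_of_mem _ hG))
      fun G hG => hP G (List.mem_cons_of_mem _ hG)
    have hd : 0 < H.dist z := hz.1
    have hk := hκ H List.mem_cons_self
    rw [← Multiset.cons_coe, sqn_cons]
    by_cases h : P H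
    · rw [Multiset.filter_cons_of_pos _ h, gramForm_cons]
      have h2 := hP H List.mem_cons_self h
      rw [Cut.μ, div_le_iff₀ hk] at h2
      have h3 : (inner ℝ H.a w / H.kappa) ^ 2 ≤ 4 * (inner ℝ H.a w / H.dist z) ^ 2 := by
        rw [div_pow, div_pow, mul_div_assoc', div_le_div_iff₀ (by positivity) (by positivity)]
        have : H.dist z ^ 2 ≤ (2 * H.kappa) ^ 2 := by gcongr
        nlinarith [sq_nonneg (inner ℝ H.a w)]
      linarith
    · rw [Multiset.filter_cons_of_neg _ h]
      linarith [sq_nonneg (inner ℝ H.a w / H.dist z)]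

lemma GramGood.card_bound {S : Multiset (Cut n)} (h : GramGood S) {κ : ℝ} (hκ : 0 < κ)
    (hS : ∀ H ∈ S, ‖H.a‖ = 1 ∧ κ ≤ H.kappa) :
    (1.01 : ℝ) ^ S.card ≤ (n + S.card * (κ ^ 2)⁻¹) ^ n := by
  have h1 := h S le_rfl
  have h2 := det_le_trace_pow (gram_posDef S)
  have h3 := trace_gram_le hκ hS
  have h4 : 0 ≤ (gram S).trace := (gram_posDef S).posSemidef.trace_nonneg
  have h5 : (gram S).trace ^ n ≤ (8 * (n + S.card * (κ ^ 2)⁻¹)) ^ n := by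
    gcongr
    have : (0 : ℝ) ≤ S.card * (κ ^ 2)⁻¹ := by positivity
    linarith
  rw [mul_pow] at h5
  exact le_of_mul_le_mul_left (h1.trans (h2.trans h5)) (by positivity)

/-! ### Separating vectors -/

/-- The standing assumptions on the convex set and the input. -/
structure Valid (K : Set (E n)) (I : Input n) : Prop where
  two_le : 2 ≤ n
  convex : Convex ℝ K
  zero_mem : (0 : E n) ∈ K
  subset : K ⊆ Metric.closedBall 0 I.R
  δ_pos : 0 < I.δ
  δ_le : I.δ ≤ I.R
  p_ne : I.p ≠ 0
  p_le : ‖I.p‖ ≤ I.R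
  oracle : IsWeakOptOracle K I.oracle

lemma mem_nbhd {K : Set (E n)} {t : ℝ} {x : E n} : x ∈ nbhd K t ↔ ∃ k ∈ K, ‖x - k‖ ≤ t := by
  simp [nbhd, dist_eq_norm]

section

variable {K : Set (E n)} {I : Input n}

lemma Valid.R_pos (hV : Valid K I) : 0 < I.R := hV.δ_pos.trans_le hV.δ_le

lemma Valid.r_pos (hV : Valid K I) : 0 < I.r := by
  have := hV.R_pos; have := hV.δ_pos
  rw [Input.r]; positivity

lemma Valid.norm_le (hV : Valid K I) {k : E n} (hk : k ∈ K) : ‖k‖ ≤ I.R := by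
  simpa using hV.subset hk

lemma Valid.exists_separating (hV : Valid K I) (hp : I.p ∉ nbhd K I.δ) :
    ∃ m : E n, ‖m‖ = 1 ∧ ∀ k ∈ K, I.δ ≤ inner ℝ m (I.p - k) := by
  have hdisj : Disjoint (Metric.ball I.p I.δ) K := by
    rw [Set.disjoint_left]
    intro k hk hkK
    refine hp (mem_nbhd.2 ⟨k, hkK, ?_⟩)
    rw [norm_sub_rev]
    exact (mem_ball_iff_norm.1 hk).le
  obtain ⟨f, u, hf, hu⟩ := geometric_hahn_banach_open (convex_ball I.p I.δ) Metric.isOpen_ball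
    hV.convex hdisj
  set g := (InnerProductSpace.toDual ℝ (E n)).symm f
  have hfg : ∀ x, f x = inner ℝ g x := fun x =>
    (InnerProductSpace.toDual_symm_apply (𝕜 := ℝ)).symm
  have hg : g ≠ 0 := by
    intro h
    have h1 := hf I.p (Metric.mem_ball_self hV.δ_pos)
    have h2 := hu 0 hV.zero_mem
    rw [hfg, h, inner_zero_left] at h1 h2
    linarith
  have hg' : 0 < ‖g‖ := norm_pos_iff.2 hg
  refine ⟨-(‖g‖⁻¹ • g), ?_, fun k hk => ?_⟩
  · rw [norm_neg, norm_smul, norm_inv, norm_norm, inv_mul_cancel₀ hg'.ne']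
  -- The separated ball is open, so δ is reached through s < δ by testing the functional at p + s
  -- g/‖g‖.
  · refine le_of_forall_lt_imp_le_of_dense fun s hs => ?_
    rcases lt_or_ge s 0 with hs0 | hs0
    · have hp1 := hf I.p (Metric.mem_ball_self hV.δ_pos)
      have hk1 := hu k hk
      rw [hfg] at hp1 hk1
      rw [inner_neg_left, real_inner_smul_left, inner_sub_right]
      have : 0 < ‖g‖⁻¹ := inv_pos.2 hg'
      nlinarith
    · have hb : I.p + (s * ‖g‖⁻¹) • g ∈ Metric.ball I.p I.δ := by
        rw [mem_ball_iff_norm, add_sub_cancel_left, norm_smul, Real.norm_of_nonneg (by positivity),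
          mul_assoc, inv_mul_cancel₀ hg'.ne', mul_one]
        exact hs
      have h1 := (hf _ hb).trans_le (hu k hk)
      rw [hfg, hfg, inner_add_right, inner_smul_right, real_inner_self_eq_norm_sq] at h1
      rw [inner_neg_left, real_inner_smul_left, inner_sub_right]
      have e : s * ‖g‖⁻¹ * ‖g‖ ^ 2 = s * ‖g‖ := by field_simp
      rw [e] at h1
      have h2 : s * ‖g‖ ≤ inner ℝ g k - inner ℝ g I.p := by linarith
      rw [← le_div_iff₀ hg'] at h2
      refine h2.trans (le_of_eq ?_)
      field_simp; ring

/-- If `p` is far from `K`, then the directions of a whole ball separate. -/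
lemma Valid.exists_ball (hV : Valid K I) (hp : I.p ∉ nbhd K I.δ) :
    ∃ y : E n, ∀ x ∈ Metric.closedBall y (I.r / 3),
      ‖x‖ ≤ 1 ∧ 0 < ‖x‖ ∧ ‖x‖⁻¹ • x ∈ Mp K I := by
  obtain ⟨m, hm, hmK⟩ := hV.exists_separating hp
  have hδ := hV.δ_pos
  have hR := hV.R_pos
  have hlt : I.δ < I.R := by
    refine lt_of_le_of_ne hV.δ_le fun h => hp (mem_nbhd.2 ⟨0, hV.zero_mem, ?_⟩)
    rw [sub_zero, h]; exact hV.p_le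
  obtain ⟨ρ, hρ⟩ : ∃ ρ, ρ = I.r / 3 := ⟨_, rfl⟩
  have hρR : ρ * (15 * I.R) = 2 * I.δ := by rw [hρ, Input.r]; field_simp; norm_num
  have hρ0 : 0 < ρ := by rw [hρ]; have := hV.r_pos; positivity
  have hρ1 : ρ < 2 / 15 := by nlinarith
  rw [← hρ]
  -- This ball touches the unit sphere at m. From the margin δ one loses ρδ by shrinking, 2Rρ =
  -- 4δ/15 by perturbing and δ/5 by passing to S(K,ε). As ρ < 2/15, more than 2δ/5 = δ' remains, and
  -- normalising only enlarges it.
  refine ⟨(1 - ρ) • m, fun x hx => ?_⟩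
  obtain ⟨v, rfl⟩ : ∃ v, x = (1 - ρ) • m + v := ⟨x - (1 - ρ) • m, by simp⟩
  have hv : ‖v‖ ≤ ρ := by simpa [mem_closedBall_iff_norm] using hx
  have hn : ‖(1 - ρ) • m‖ = 1 - ρ := by
    rw [norm_smul, hm, mul_one, Real.norm_of_nonneg (by linarith)]
  set x := (1 - ρ) • m + v with hxdef
  have hx1 : ‖x‖ ≤ 1 := by
    have := norm_add_le ((1 - ρ) • m) v
    rw [hn] at this; linarith
  have hx0 : 0 < ‖x‖ := by
    have := norm_sub_le_norm_add ((1 - ρ) • m) v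
    rw [hn] at this; linarith
  refine ⟨hx1, hx0, ?_, fun k hk => ?_⟩
  · rw [norm_smul, norm_inv, norm_norm, inv_mul_cancel₀ hx0.ne']
  · obtain ⟨k', hk', hkk⟩ := mem_nbhd.1 hk
    have h1 := hmK k' hk'
    have h2 : ‖I.p - k'‖ ≤ 2 * I.R := by
      have := norm_sub_le I.p k'
      have := hV.p_le
      have := hV.norm_le hk'
      linarith
    have h3 := (abs_le.1 (abs_real_inner_le_norm v (I.p - k'))).1
    have h4 : ‖v‖ * ‖I.p - k'‖ ≤ ρ * (2 * I.R) := by gcongr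
    have h5 := real_inner_le_norm x (k - k')
    have h6 : ‖x‖ * ‖k - k'‖ ≤ 1 * I.ε := by gcongr
    have h7 : inner ℝ x (I.p - k) = (1 - ρ) * inner ℝ m (I.p - k') +
        inner ℝ v (I.p - k') - inner ℝ x (k - k') := by
      have : I.p - k = (I.p - k') - (k - k') := by abel
      rw [this, inner_sub_right, hxdef, inner_add_left, real_inner_smul_left]
    have h8 : (1 - ρ) * I.δ ≤ (1 - ρ) * inner ℝ m (I.p - k') := by
      have : 0 ≤ 1 - ρ := by linarith
      gcongr
    have hε : I.ε = I.δ / 5 := rfl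
    have hδ' : I.δ' = 2 * I.δ / 5 := rfl
    have h9 : I.δ' < inner ℝ x (I.p - k) := by nlinarith
    have hδ'0 : 0 < I.δ' := by rw [hδ']; positivity
    have h10 : I.δ' < ‖x‖⁻¹ * inner ℝ x (I.p - k) := by
      refine h9.trans_le (le_mul_of_one_le_left (hδ'0.trans h9).le ?_)
      exact (one_le_inv₀ hx0).2 hx1
    rw [real_inner_smul_left, real_inner_smul_left]
    rw [inner_sub_right] at h10
    linarith

end

/-! ### The invariant of the main loop -/

/-- The first cut. -/
def cut₁ (I : Input n) : Cut n := ⟨(‖I.p‖)⁻¹ • I.p, 0, 1 / √3⟩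

/-- What every cut satisfies. -/
structure GoodCut (K : Set (E n)) (I : Input n) (H : Cut n) : Prop where
  norm : ‖H.a‖ = 1
  le_b : -3 ≤ H.b
  b_le : H.b ≤ 0
  kappa_pos : 0 < H.kappa
  kappa_le : H.kappa ≤ 4
  inner_pos : ∀ m ∈ Mp K I, 0 < inner ℝ H.a m

/-- The invariant of the main loop. -/
structure Inv (K : Set (E n)) (I : Input n) (s : State n) : Prop where
  head : ∃ T, s.cuts = cut₁ I :: T
  mem : s.z ∈ dom s.cuts
  centred : Centred s.cuts I.δt s.z
  good : ∀ H ∈ s.cuts, GoodCut K I H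

section

variable {K : Set (E n)} {I : Input n} {s s' : State n}

lemma Valid.norm_cut₁ (hV : Valid K I) : ‖(cut₁ I).a‖ = 1 := by
  have : 0 < ‖I.p‖ := norm_pos_iff.2 hV.p_ne
  simp only [cut₁]
  rw [norm_smul, norm_inv, norm_norm, inv_mul_cancel₀ this.ne']

lemma Valid.δt_pos (hV : Valid K I) : 0 < I.δt := by
  have := hV.R_pos; have := hV.δ_pos
  rw [Input.δt, Input.δ']; positivity

lemma sqrt_three_bounds : (1.732 : ℝ) ≤ √3 ∧ √3 ≤ (1.74 : ℝ) :=
  ⟨Real.le_sqrt_of_sq_le (by norm_num), Real.sqrt_le_iff.2 ⟨by norm_num, by norm_num⟩⟩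

lemma GoodCut.dist_le {H : Cut n} (hH : GoodCut K I H) {x : E n} (hx : ‖x‖ ≤ 1) :
    H.dist x ≤ 4 := by
  have h1 := real_inner_le_norm H.a x
  rw [hH.norm, one_mul] at h1
  have := hH.le_b
  rw [Cut.dist]; linarith

lemma Valid.goodCut₁ (hV : Valid K I) : GoodCut K I (cut₁ I) where
  norm := hV.norm_cut₁
  le_b := by norm_num [cut₁]
  b_le := by norm_num [cut₁]
  kappa_pos := by simp [cut₁]
  kappa_le := by
    have := sqrt_three_bounds.1
    simp only [cut₁]
    rw [div_le_iff₀ (by positivity)]; linarith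
  inner_pos := by
    intro m hm
    have h0 : (0 : E n) ∈ nbhd K I.ε := mem_nbhd.2 ⟨0, hV.zero_mem, by
      have := hV.δ_pos
      simp only [sub_zero, norm_zero, Input.ε]; positivity⟩
    have h1 := hm.2 0 h0
    have h2 : 0 < I.δ' := by have := hV.δ_pos; rw [Input.δ']; positivity
    have h3 : 0 < ‖I.p‖ := norm_pos_iff.2 hV.p_ne
    rw [inner_zero_right] at h1
    simp only [cut₁]
    rw [real_inner_smul_left, real_inner_comm]
    have : 0 < inner ℝ m I.p := by linarith
    positivity

lemma Valid.gradForm_init (hV : Valid K I) :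
    (init I).z ∈ dom (init I).cuts ∧ gradForm (init I).cuts (init I).z = 0 := by
  have ha := hV.norm_cut₁
  have h3 : 0 < √3 := by positivity
  have hs : √3 ^ 2 = 3 := Real.sq_sqrt (by norm_num)
  have hz : (init I).z = (1 / √3) • (cut₁ I).a := rfl
  have hc : (init I).cuts = [cut₁ I] := rfl
  have hd : (cut₁ I).dist ((1 / √3) • (cut₁ I).a) = 1 / √3 := by
    rw [Cut.dist, inner_smul_right, real_inner_self_eq_norm_sq, ha]
    simp [cut₁]
  have hn : ‖(1 / √3) • (cut₁ I).a‖ = 1 / √3 := by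
    rw [norm_smul, ha, mul_one, Real.norm_of_nonneg (by positivity)]
  have h1 := sqrt_three_bounds.1
  rw [hz, hc]
  constructor
  · rw [dom_cons, dom_nil]
    refine ⟨?_, ?_⟩
    · rw [Set.mem_ofPred_eq, hd]; positivity
    · rw [Set.mem_ofPred_eq, hn, div_lt_one h3]; linarith
  · rw [gradForm, gradForm, hd, hn, smul_smul, ← sub_smul]
    have : 2 / (1 - (1 / √3) ^ 2) * (1 / √3) - (1 / √3)⁻¹ = 0 := by
      rw [div_pow, hs]; field_simp; rw [hs]; norm_num
    rw [this, zero_smul]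

lemma Valid.inv_init (hV : Valid K I) : Inv K I (init I) where
  head := ⟨[], rfl⟩
  mem := hV.gradForm_init.1
  centred := by
    obtain ⟨h1, h2⟩ := hV.gradForm_init
    have h3 : lam (init I).cuts (init I).z = 0 := by
      rw [lam, grad_eq h1, h2, inner_zero_left, Real.sqrt_zero]
    have hd := hV.δt_pos
    have hz : 0 < ‖(init I).z‖ := by
      have : (init I).z = (1 / √3) • (cut₁ I).a := rfl
      rw [this, norm_smul, hV.norm_cut₁, mul_one, norm_pos_iff]
      positivity
    refine ⟨?_, ?_⟩
    · rw [h3]; norm_num [ρ₀]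
    · rw [h3, q_zero]; positivity
  good := by
    intro H hH
    rw [show (init I).cuts = [cut₁ I] from rfl, List.mem_singleton] at hH
    rw [hH]; exact hV.goodCut₁

lemma Inv.lam_lt (h : Inv K I s) : lam s.cuts s.z < ρ₀ := h.centred.1

lemma Inv.cut₁_mem (h : Inv K I s) : cut₁ I ∈ s.cuts := by
  obtain ⟨T, hT⟩ := h.head
  rw [hT]; exact List.mem_cons_self

lemma Inv.dist_cut₁ (h : Inv K I s) : 0 < (cut₁ I).dist s.z ∧ (cut₁ I).dist s.z ≤ ‖s.z‖ := by
  refine ⟨h.mem.1 _ h.cut₁_mem, ?_⟩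
  have h1 := real_inner_le_norm (cut₁ I).a s.z
  rw [(h.good _ h.cut₁_mem).norm, one_mul] at h1
  simpa [Cut.dist, cut₁] using h1

lemma Inv.norm_z_pos (h : Inv K I s) : 0 < ‖s.z‖ := h.dist_cut₁.1.trans_le h.dist_cut₁.2

lemma Inv.norm_c (h : Inv K I s) : ‖s.c‖ = 1 := by
  rw [State.c, norm_smul, norm_inv, norm_norm, inv_mul_cancel₀ h.norm_z_pos.ne']

/-- The first cut never doubles its distance. -/
lemma Inv.μ_cut₁ (h : Inv K I s) : ¬ 2 < (cut₁ I).μ s.z := by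
  have h1 := sqrt_three_bounds
  have h2 := h.dist_cut₁
  have h3 : ‖s.z‖ < 1 := h.mem.2
  have h4 : (cut₁ I).μ s.z = (cut₁ I).dist s.z * √3 := by
    rw [Cut.μ, show (cut₁ I).kappa = 1 / √3 from rfl, one_div, div_inv_eq_mul]
  rw [h4]
  nlinarith

/-- The test vector almost lies in the polar of every separating vector. -/
lemma Inv.inner_c_ge (hV : Valid K I) (h : Inv K I s) {m : E n} (hm : m ∈ Mp K I) :
    -(I.δt / 2) ≤ inner ℝ s.c m := by
  obtain ⟨v, hv, hg, hq⟩ := exists_centre h.mem h.lam_lt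
  have h1 := inner_centre_nonneg hv hg (m := m) fun H hH => ((h.good H hH).inner_pos m hm).le
  have hz := h.norm_z_pos
  have hd := hV.δt_pos
  have h2 := h.centred.2
  have h3 : ‖v‖ * √2 ≤ √(sqn s.cuts s.z v) := by
    apply Real.le_sqrt_of_sq_le
    rw [mul_pow, Real.sq_sqrt (by norm_num)]
    have := two_normSq_le h.mem v
    rw [sqn]; linarith
  have h4 : ‖v‖ * √2 < I.δt / (1 + I.δt) * (‖s.z‖ / √2) := h3.trans_lt (hq.trans_lt h2)
  have h5 : ‖v‖ ≤ I.δt / 2 * ‖s.z‖ := by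
    have h6 : I.δt / (1 + I.δt) ≤ I.δt := div_le_self hd.le (by linarith)
    have h7 : I.δt / (1 + I.δt) * (‖s.z‖ / √2) ≤ I.δt * (‖s.z‖ / √2) := by gcongr
    have h8 : 0 < √2 := by positivity
    have h9 : √2 * √2 = 2 := Real.mul_self_sqrt (by norm_num)
    have h10 : ‖v‖ * √2 * √2 ≤ I.δt * (‖s.z‖ / √2) * √2 := by
      have := h4.le.trans h7
      gcongr
    rw [mul_assoc, h9, mul_assoc, div_mul_cancel₀ _ h8.ne'] at h10
    linarith
  have h6 := real_inner_le_norm v m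
  rw [hm.1, mul_one] at h6
  rw [inner_add_left] at h1
  rw [State.c, real_inner_smul_left, inv_mul_eq_div, le_div_iff₀ hz]
  linarith

lemma Valid.oracle_mem (hV : Valid K I) (s : State n) : s.k I ∈ nbhd K I.ε ∧
    ∀ x ∈ K, inner ℝ s.c x ≤ inner ℝ s.c (s.k I) + I.ε :=
  hV.oracle s.c I.ε (by have := hV.δ_pos; rw [Input.ε]; positivity)

/-- New cuts keep every separating vector. -/
lemma Inv.inner_cutNormal_pos (hV : Valid K I) (h : Inv K I s) (hacc : ¬ s.Accepts I)
    (hcase : s.Case2) {a : E n} (ha : s.IsCutNormal I a) {m : E n} (hm : m ∈ Mp K I) :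
    0 < inner ℝ a m := by
  obtain ⟨ha1, -, t, ht, hta⟩ := ha
  have hlt : inner ℝ s.c I.p < inner ℝ s.c (s.k I) + I.δ / 5 := by
    by_contra! hc
    exact hacc ⟨hcase, hc⟩
  have hk := (hV.oracle_mem s).1
  have hmk := hm.2 _ hk
  obtain ⟨k', hk', hkk⟩ := mem_nbhd.1 hk
  have hδ := hV.δ_pos
  have hR := hV.R_pos
  have hδR := hV.δ_le
  have hε : I.ε = I.δ / 5 := rfl
  have hδ' : I.δ' = 2 * I.δ / 5 := rfl
  have hnorm : ‖I.p - s.k I‖ ≤ 2.2 * I.R := by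
    have e : I.p - s.k I = I.p - k' - (s.k I - k') := by abel
    have h1 := norm_sub_le (I.p - k') (s.k I - k')
    have h2 := norm_sub_le I.p k'
    have h3 := hV.p_le
    have h4 := hV.norm_le hk'
    rw [e]; linarith
  set τ := inner ℝ s.c (I.p - s.k I) with hτ
  have hτ1 : τ < I.δ / 5 := by rw [hτ, inner_sub_right]; linarith
  have hτ2 : -(2.2 * I.R) ≤ τ := by
    have h1 := (abs_le.1 (abs_real_inner_le_norm s.c (I.p - s.k I))).1
    rw [h.norm_c, one_mul] at h1
    linarith
  have he1 := h.inner_c_ge hV hm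
  have he2 : inner ℝ s.c m ≤ 1 := by
    have := real_inner_le_norm s.c m
    rwa [h.norm_c, hm.1, one_mul] at this
  set e := inner ℝ s.c m
  have hd : I.δt * (10 * I.R) = I.δ := by
    rw [Input.δt, hδ']; field_simp; norm_num
  -- Here τ ∈ [-2.2R, δ/5) and e ∈ [-δ̃/2, 1]. The product is below δ/5 when both are nonnegative
  -- and at most 0.11δ when both are negative.
  have hτe : τ * e < 2 * I.δ / 5 := by
    rcases le_or_gt 0 τ with h0 | h0 <;> rcases le_or_gt 0 e with h1 | h1
    · nlinarith
    · nlinarith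
    · nlinarith
    · have : (-τ) * (-e) ≤ 2.2 * I.R * (I.δt / 2) := by
        have := hV.δt_pos
        gcongr <;> linarith
      linarith
  -- Strictness also settles ā = 0: then t = 0 contradicts this, so M_p is empty and any orthogonal
  -- a is harmless.
  have hpos : 0 < inner ℝ (t • a) m := by
    rw [← hta, inner_sub_left, real_inner_smul_left, inner_sub_left, real_inner_comm m I.p,
      real_inner_comm m (s.k I)]
    linarith
  rw [real_inner_smul_left] at hpos
  by_contra! hc
  exact hpos.not_ge (mul_nonpos_of_nonneg_of_nonpos ht hc)

end

section Execution

variable {K : Set (E n)} {I : Input n} {s s' : State n}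

/-! ### One iteration -/

/-- The potential of a state. -/
def State.potential (s : State n) : ℝ :=
  F s.cuts s.z + (s.cuts.map fun H => Real.log H.kappa).sum

lemma perm_get_eraseIdx (L : List (Cut n)) (j : Fin L.length) :
    L.Perm (L.get j :: L.eraseIdx j) :=
  (List.getElem_cons_eraseIdx_perm j.2).symm

lemma set_perm (L : List (Cut n)) (j : Fin L.length) (G : Cut n) :
    (L.set j G).Perm (G :: L.eraseIdx j) :=
  List.set_perm_cons_eraseIdx j.2 G

/-- The first cut is never discarded or reset, so the cut through 0 needed by `exists_recentres` is
always present. -/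
lemma Inv.index_ne_zero (h : Inv K I s) {j : Fin s.cuts.length}
    (hj : 2 < (s.cuts.get j).μ s.z) : (j : ℕ) ≠ 0 := by
  intro h0
  have key : ∀ (L : List (Cut n)) (c : Cut n) (T) (_ : L = c :: T) (j : Fin L.length),
      (j : ℕ) = 0 → L.get j = c := by
    rintro L c T rfl j hj
    simp [hj]
  obtain ⟨T, hT⟩ := h.head
  rw [key _ _ T hT j h0] at hj
  exact h.μ_cut₁ hj

/-- A cut with the same normal and offset, whose reference distance is its distance. -/
lemma GoodCut.reset {H : Cut n} (hH : GoodCut K I H) {z : E n} (hz : ‖z‖ ≤ 1)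
    (hd : 0 < H.dist z) : GoodCut K I ⟨H.a, H.b, H.dist z⟩ :=
  ⟨hH.norm, hH.le_b, hH.b_le, hd, hH.dist_le hz, hH.inner_pos⟩

lemma F_set (L : List (Cut n)) (j : Fin L.length) (k : ℝ) :
    F (L.set j ⟨(L.get j).a, (L.get j).b, k⟩) = F L := by
  rw [F_perm (set_perm _ _ _), F_perm (perm_get_eraseIdx L j)]
  funext x
  rw [F_cons, F_cons]; rfl

lemma dom_set (L : List (Cut n)) (j : Fin L.length) (k : ℝ) :
    dom (L.set j ⟨(L.get j).a, (L.get j).b, k⟩) = dom L := by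
  rw [dom_perm (set_perm _ _ _), dom_perm (perm_get_eraseIdx L j), dom_cons, dom_cons]; rfl

/-- Everything that is needed about the addition of a cut. -/
lemma Inv.add_spec (hV : Valid K I) (h : Inv K I s) {a : E n}
    (hE : (Branch.add a : Branch s).Enabled I) {β : ℝ} (hβ : β < 0)
    (hγ : inner ℝ a (hessInv s.cuts s.z a) / (inner ℝ a s.z - β) ^ 2 = γ₀ ^ 2)
    (hc : s'.cuts = s.cuts ++ [⟨a, β, inner ℝ a s'.z - β⟩])
    (hr : Recentres s'.cuts I.δt s.z s'.z) :
    s'.z ∈ dom s'.cuts ∧ GoodCut K I ⟨a, β, inner ℝ a s'.z - β⟩ ∧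
      F s.cuts s.z + 0.003 ≤ F s.cuts s'.z ∧
      inner ℝ a s'.z - β ≤ 5 / 4 * (inner ℝ a s.z - β) ∧ inner ℝ a s.z = 0 := by
  obtain ⟨hcase, hacc, hcut⟩ := hE
  have hz0 := h.norm_z_pos
  have haz : inner ℝ a s.z = 0 := by
    have := hcut.2.1
    rw [State.c, inner_smul_right] at this
    exact (mul_eq_zero.1 this).resolve_left (inv_pos.2 hz0).ne'
  have hperm := hc ▸ List.perm_append_singleton (⟨a, β, inner ℝ a s'.z - β⟩ : Cut n) s.cuts
  set G : Cut n := ⟨a, β, inner ℝ a s'.z - β⟩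
  have hd : 0 < G.dist s.z := by simp only [Cut.dist, G, haz]; linarith
  have hzd : s.z ∈ dom s'.cuts := by
    rw [dom_perm hperm, dom_cons]; exact ⟨hd, h.mem⟩
  have hz' := hr.mem_dom hzd
  have hz'G := hz'
  rw [dom_perm hperm] at hz'G
  have hl' : lam (G :: s.cuts) s'.z < ρ₀ := by
    rw [← lam_congr (F_perm hperm)]; exact hr.centred.1
  have hadd := F_add h.mem h.lam_lt hd hγ hz'G hl'
  have hd' : 0 < G.dist s'.z := hz'G.1 G List.mem_cons_self
  -- The Hessian is at least 2I, so β² = 16 aᵀ∇²F⁻¹a ≤ 8.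
  have hb3 : -3 ≤ β := by
    have h1 := inner_hessInv_le h.mem a
    rw [haz, div_eq_iff (by have := hβ.ne; positivity), γ₀] at hγ
    rw [hcut.1] at h1
    by_contra! hb
    nlinarith
  have h1 := real_inner_le_norm a s'.z
  rw [hcut.1, one_mul] at h1
  have h2 : ‖s'.z‖ < 1 := hz'.2
  refine ⟨hz', ⟨hcut.1, hb3, hβ.le, hd', ?_, fun m hm =>
    h.inner_cutNormal_pos hV hacc hcase hcut hm⟩, hadd.1, hadd.2, haz⟩
  simp only [G]; linarith

lemma Inv.discard_mem_dom (h : Inv K I s) (j : Fin s.cuts.length) :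
    s.z ∈ dom (s.cuts.eraseIdx j) := by
  have := h.mem
  rw [dom_perm (perm_get_eraseIdx s.cuts j), dom_cons] at this
  exact this.2

lemma Inv.step (hV : Valid K I) (h : Inv K I s) {B : Branch s} (hE : B.Enabled I)
    (hR : B.Result I s s') : Inv K I s' := by
  obtain ⟨T, hT⟩ := h.head
  cases B with
  | discard j =>
    obtain ⟨hc, hr⟩ := hR
    refine ⟨?_, ?_, hr.centred, fun H hH => h.good H ?_⟩
    · obtain ⟨k, hk⟩ := Nat.exists_eq_succ_of_ne_zero (h.index_ne_zero hE.1)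
      exact ⟨T.eraseIdx k, by rw [hc, hk, hT]; rfl⟩
    · exact hr.mem_dom (hc ▸ h.discard_mem_dom j)
    · rw [hc] at hH; exact List.mem_of_mem_eraseIdx hH
  | reset j =>
    obtain ⟨hz, hc⟩ := hR
    refine ⟨?_, ?_, ?_, fun H hH => ?_⟩
    · obtain ⟨k, hk⟩ := Nat.exists_eq_succ_of_ne_zero (h.index_ne_zero hE.1)
      rw [hc, hk]
      generalize (⟨_, _, _⟩ : Cut n) = G
      exact ⟨T.set k G, by rw [hT]; rfl⟩
    · rw [hz, hc, dom_set]; exact h.mem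
    · rw [hz, hc, Centred_congr (F_set _ _ _)]; exact h.centred
    · rw [hc] at hH
      rcases List.mem_or_eq_of_mem_set hH with h1 | rfl
      · exact h.good H h1
      · have hj : s.cuts.get j ∈ s.cuts := List.get_mem _ _
        exact (h.good _ hj).reset h.mem.2.le (h.mem.1 _ hj)
  | add a =>
    obtain ⟨β, hβ, hγ, hc, hr⟩ := hR
    obtain ⟨h1, h2, -⟩ := h.add_spec hV hE hβ hγ hc hr
    refine ⟨⟨T ++ [_], by rw [hc, hT]; rfl⟩, h1, hr.centred, fun H hH => ?_⟩
    rw [hc, List.mem_append, List.mem_singleton] at hH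
    rcases hH with hH | rfl
    · exact h.good H hH
    · exact h2

lemma potential_eq_of_perm {L : List (Cut n)} {G : Cut n} {M : List (Cut n)}
    (h : L.Perm (G :: M)) :
    (L.map fun H => Real.log H.kappa).sum =
      Real.log G.kappa + (M.map fun H => Real.log H.kappa).sum := by
  rw [(h.map _).sum_eq, List.map_cons, List.sum_cons]

lemma Inv.potential_step (hV : Valid K I) (h : Inv K I s) {B : Branch s} (hE : B.Enabled I)
    (hR : B.Result I s s') : s.potential + 0.003 ≤ s'.potential := by
  have hlog2 := Real.log_two_gt_d9
  have hlogμ : ∀ j : Fin s.cuts.length, 2 < (s.cuts.get j).μ s.z →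
      Real.log 2 + Real.log (s.cuts.get j).kappa ≤ Real.log ((s.cuts.get j).dist s.z) := by
    intro j hj
    have hk := (h.good _ (List.get_mem s.cuts j)).kappa_pos
    rw [Cut.μ, lt_div_iff₀ hk] at hj
    rw [← Real.log_mul two_ne_zero hk.ne']
    exact Real.log_le_log (by positivity) hj.le
  cases B with
  | discard j =>
    obtain ⟨hc, hr⟩ := hR
    have hp := perm_get_eraseIdx s.cuts j
    have hz := h.mem
    rw [dom_perm hp] at hz
    have hl := h.lam_lt
    rw [lam_congr (F_perm hp)] at hl
    have hs := hE.2
    rw [sig_congr (F_perm hp)] at hs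
    have hz' : s'.z ∈ dom (s.cuts.eraseIdx j) := by
      rw [← hc]; exact hr.mem_dom (hc ▸ h.discard_mem_dom j)
    have h1 := F_discard hz hl hs hz'
    have h2 := hlogμ j hE.1
    rw [State.potential, State.potential, potential_eq_of_perm hp, F_perm hp, hc]
    linarith
  | reset j =>
    obtain ⟨hz, hc⟩ := hR
    have h2 := hlogμ j hE.1
    rw [State.potential, State.potential, hz, hc, F_set,
      potential_eq_of_perm (perm_get_eraseIdx s.cuts j), potential_eq_of_perm (set_perm _ _ _)]
    linarith
  | add a =>
    obtain ⟨β, hβ, hγ, hc, hr⟩ := hR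
    obtain ⟨h1, h2, h3, -⟩ := h.add_spec hV hE hβ hγ hc hr
    have hperm := hc ▸ List.perm_append_singleton (⟨a, β, inner ℝ a s'.z - β⟩ : Cut n) s.cuts
    rw [State.potential, State.potential, potential_eq_of_perm hperm, F_perm hperm, F_cons]
    simp only [Cut.dist]
    linarith

/-- Every iteration can be carried out. -/
lemma Inv.exists_result (hV : Valid K I) (h : Inv K I s) {B : Branch s} (hE : B.Enabled I) :
    ∃ s', B.Result I s s' := by
  obtain ⟨T, hT⟩ := h.head
  have ha₁ := hV.norm_cut₁
  cases B with
  | discard j =>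
    obtain ⟨k, hk⟩ := Nat.exists_eq_succ_of_ne_zero (h.index_ne_zero hE.1)
    have hc : s.cuts.eraseIdx j = cut₁ I :: T.eraseIdx k := by rw [hk, hT]; rfl
    have hz := h.discard_mem_dom j
    rw [hc] at hz
    obtain ⟨z', hz'⟩ := exists_recentres ha₁ rfl hV.δt_pos hz
    exact ⟨⟨s.cuts.eraseIdx j, z'⟩, rfl, by rw [hc]; exact hz'⟩
  | reset j => exact ⟨⟨s.cuts.set j
      ⟨(s.cuts.get j).a, (s.cuts.get j).b, (s.cuts.get j).dist s.z⟩, s.z⟩, rfl, rfl⟩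
  | add a =>
    obtain ⟨hcase, hacc, hcut⟩ := hE
    have haz : inner ℝ a s.z = 0 := by
      have := hcut.2.1
      rw [State.c, inner_smul_right] at this
      exact (mul_eq_zero.1 this).resolve_left (inv_pos.2 h.norm_z_pos).ne'
    have ha0 : a ≠ 0 := by
      rintro rfl; simpa using hcut.1
    have hQ := inner_hessInv_pos h.mem ha0
    set Q := inner ℝ a (hessInv s.cuts s.z a) with hQdef
    have hγ0 : 0 < γ₀ := by norm_num [γ₀]
    set β := -(√Q / γ₀)
    have hβ : β < 0 := neg_lt_zero.2 (div_pos (Real.sqrt_pos.2 hQ) hγ0)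
    have hF : ∀ κ : ℝ, F (s.cuts ++ [(⟨a, β, κ⟩ : Cut n)]) =
        F (cut₁ I :: (T ++ [(⟨a, β, 0⟩ : Cut n)])) := by
      intro κ
      have hp : ∀ κ : ℝ, (s.cuts ++ [(⟨a, β, κ⟩ : Cut n)]).Perm (⟨a, β, κ⟩ :: s.cuts) :=
        fun κ => List.perm_append_singleton _ _
      rw [← List.cons_append, ← hT, F_perm (hp κ), F_perm (hp 0)]
      funext x
      rw [F_cons, F_cons]; rfl
    have hz : s.z ∈ dom (cut₁ I :: (T ++ [(⟨a, β, 0⟩ : Cut n)])) := by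
      rw [← List.cons_append, ← hT, dom_perm (List.perm_append_singleton _ _), dom_cons]
      refine ⟨?_, h.mem⟩
      rw [Set.mem_ofPred_eq, Cut.dist, haz]
      simp only; linarith
    obtain ⟨z', hz'⟩ := exists_recentres ha₁ rfl hV.δt_pos hz
    refine ⟨⟨s.cuts ++ [⟨a, β, inner ℝ a z' - β⟩], z'⟩, β, hβ, ?_, rfl, ?_⟩
    · rw [haz, ← hQdef, zero_sub, neg_neg, div_pow, Real.sq_sqrt hQ.le]
      field_simp
    · have e := Recentres_congr (hF (inner ℝ a z' - β))
      exact (congrFun (congrFun (congrFun e I.δt) s.z) z').mpr hz'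

lemma exists_unit_orthogonal (hn : 2 ≤ n) (c : E n) : ∃ a : E n, ‖a‖ = 1 ∧ inner ℝ a c = 0 := by
  have hne : (Submodule.span ℝ {c})ᗮ ≠ ⊥ := by
    rw [Ne, Submodule.orthogonal_eq_bot_iff]
    intro h
    have h1 := finrank_span_le_card (R := ℝ) ({c} : Set (E n))
    rw [h, finrank_top, finrank_euclideanSpace_fin] at h1
    simp at h1
    omega
  obtain ⟨x, hx, hx0⟩ := Submodule.exists_mem_ne_zero_of_ne_bot hne
  have hx' : 0 < ‖x‖ := norm_pos_iff.2 hx0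
  refine ⟨‖x‖⁻¹ • x, ?_, ?_⟩
  · rw [norm_smul, norm_inv, norm_norm, inv_mul_cancel₀ hx'.ne']
  · rw [real_inner_smul_left, real_inner_comm,
      Submodule.mem_orthogonal_singleton_iff_inner_right.1 hx, mul_zero]

/-- Some branch is always open. -/
lemma Inv.exists_branch (hV : Valid K I) (h : Inv K I s) :
    s.Accepts I ∨ ∃ B : Branch s, B.Enabled I := by
  by_cases hcase : s.Case2
  · by_cases hacc : s.Accepts I
    · exact Or.inl hacc
    · right
      set x := (I.p - s.k I) - (inner ℝ s.c (I.p - s.k I)) • s.c with hx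
      by_cases hx0 : x = 0
      · obtain ⟨a, ha, hac⟩ := exists_unit_orthogonal hV.two_le s.c
        exact ⟨.add a, hcase, hacc, ha, hac, 0, le_rfl, by rw [← hx, hx0, zero_smul]⟩
      · have hx' : 0 < ‖x‖ := norm_pos_iff.2 hx0
        refine ⟨.add (‖x‖⁻¹ • x), hcase, hacc, ?_, ?_, ‖x‖, hx'.le, ?_⟩
        · rw [norm_smul, norm_inv, norm_norm, inv_mul_cancel₀ hx'.ne']
        · rw [real_inner_smul_left, hx, inner_sub_left, real_inner_smul_left,
            real_inner_self_eq_norm_sq, h.norm_c, real_inner_comm s.c]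
          ring
        · rw [← hx, smul_smul, mul_inv_cancel₀ hx'.ne', one_smul]
  · right
    have hcase' := hcase
    simp only [State.Case2, not_forall, not_le] at hcase'
    obtain ⟨H, hH, hμ⟩ := hcase'
    by_cases hd : ∃ G ∈ s.cuts, 2 < G.μ s.z ∧ sig s.cuts G s.z < σ₀
    · obtain ⟨G, hG, hG2⟩ := hd
      obtain ⟨j, rfl⟩ := List.get_of_mem hG
      exact ⟨.discard j, hG2⟩
    · push Not at hd
      obtain ⟨j, rfl⟩ := List.get_of_mem hH
      exact ⟨.reset j, hμ, fun G hG hG2 => (hd G hG hG2.1).not_gt hG2.2⟩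

/-! ### The second stopping condition -/

lemma one_add_ζ₀_le : 1 + ζ₀ ≤ 1 / (1 - ζ₀) := by
  have h1 := ζ₀_le
  rw [le_div_iff₀ (by linarith)]
  nlinarith [sq_nonneg ζ₀]

/-- A ball in the search space bounds the distances of the approximate centre from below. -/
lemma Inv.width (h : Inv K I s) {y : E n} {ρ : ℝ} (hρ : 0 ≤ ρ)
    (hball : ∀ x ∈ Metric.closedBall y ρ, ‖x‖ ≤ 1 ∧ ∀ H ∈ s.cuts, 0 ≤ H.dist x) {H : Cut n}
    (hH : H ∈ s.cuts) : 2 * ρ ≤ (s.cuts.length + 1) * (H.dist s.z / (1 - ζ₀)) := by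
  obtain ⟨v, hv, hg, hq⟩ := exists_centre h.mem h.lam_lt
  have hn := (h.good H hH).norm
  have hmem : ∀ t : ℝ, |t| ≤ ρ → y + t • H.a ∈ Metric.closedBall y ρ := fun t ht => by
    rwa [mem_closedBall_iff_norm, add_sub_cancel_left, norm_smul, hn, mul_one, Real.norm_eq_abs]
  obtain ⟨h1, h2⟩ := hball _ (hmem ρ (by rw [abs_of_nonneg hρ]))
  have h3 := (hball _ (hmem (-ρ) (by rw [abs_neg, abs_of_nonneg hρ]))).2 H hH
  have h4 := dist_le_mul_centre hv hg h1 h2 hH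
  rw [dist_add, inner_smul_right, real_inner_self_eq_norm_sq, hn] at h3 h4
  have h5 := abs_inner_le_dist h.mem v hH
  have hd := h.mem.1 H hH
  have h6 : H.dist (s.z + v) ≤ H.dist s.z / (1 - ζ₀) := by
    have h7 : √(sqn s.cuts s.z v) ≤ ζ₀ := hq.trans (q_le_ζ₀ h.lam_lt)
    have h8 : H.dist s.z * (1 + √(sqn s.cuts s.z v)) ≤ H.dist s.z * (1 / (1 - ζ₀)) := by
      have := one_add_ζ₀_le
      gcongr
      linarith
    rw [dist_add]
    have := le_abs_self (inner ℝ H.a v)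
    rw [mul_one_div] at h8
    linarith
  have h9 : ((s.cuts.length : ℝ) + 1) * H.dist (s.z + v) ≤
      (s.cuts.length + 1) * (H.dist s.z / (1 - ζ₀)) := by gcongr
  linarith

lemma Inv.width_of_far (hV : Valid K I) (h : Inv K I s) (hp : I.p ∉ nbhd K I.δ) {H : Cut n}
    (hH : H ∈ s.cuts) :
    2 * (I.r / 3) ≤ (s.cuts.length + 1) * (H.dist s.z / (1 - ζ₀)) := by
  obtain ⟨y, hy⟩ := hV.exists_ball hp
  have hr := hV.r_pos
  refine h.width (by positivity) (y := y) (fun x hx => ?_) hH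
  obtain ⟨h1, h2, h3⟩ := hy x hx
  refine ⟨h1, fun G hG => ?_⟩
  have h4 := (h.good G hG).inner_pos _ h3
  have h5 := (h.good G hG).b_le
  rw [inner_smul_right] at h4
  have h6 : 0 < inner ℝ G.a x := (mul_pos_iff_of_pos_left (inv_pos.2 h2)).1 h4
  rw [Cut.dist]; linarith

/-- The right-hand side is convex and contains M_p; it contains 0 because every b ≤ 0. -/
lemma Inv.Kp_subset (h : Inv K I s) :
    Kp K I ⊆ {x | ‖x‖ ≤ 1 ∧ ∀ H ∈ s.cuts, 0 ≤ H.dist x} := by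
  refine Set.sdiff_subset.trans (convexHull_min ?_ ?_)
  · rintro x (hx | hx)
    · refine ⟨hx.1.le, fun G hG => ?_⟩
      have h4 := (h.good G hG).inner_pos _ hx
      have h5 := (h.good G hG).b_le
      rw [Cut.dist]; linarith
    · rw [Set.mem_singleton_iff.1 hx]
      refine ⟨by simp, fun G hG => ?_⟩
      have h5 := (h.good G hG).b_le
      rw [Cut.dist, inner_zero_right]; linarith
  · intro x hx y hy a b ha hb hab
    refine ⟨?_, fun G hG => ?_⟩
    · have := convex_closedBall (0 : E n) 1 (mem_closedBall_zero_iff.2 hx.1)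
        (mem_closedBall_zero_iff.2 hy.1) ha hb hab
      exact mem_closedBall_zero_iff.1 this
    · have e : G.dist (a • x + b • y) = a * G.dist x + b * G.dist y := by
        simp only [Cut.dist, inner_add_right, inner_smul_right]
        linear_combination G.b * hab
      rw [e]
      have := hx.2 G hG
      have := hy.2 G hG
      positivity

/-- Both claims come from `Inv.width`, with radii r and r/3. The second radius yields 2r ≤ (3h +
3)·dist/(1 - ζ₀), which the factor 3h + 4 excludes. -/
lemma Inv.stop2_sound (hV : Valid K I) (h : Inv K I s) (hs : s.Stop2 I) :
    (∀ x : E n, ¬ Metric.closedBall x I.r ⊆ Kp K I) ∧ I.p ∈ nbhd K I.δ := by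
  obtain ⟨H, hH, hlt⟩ := hs
  have hr := hV.r_pos
  have hD : 0 < H.dist s.z / (1 - ζ₀) := div_pos (h.mem.1 H hH) (by linarith [ζ₀_le])
  have hh : (0 : ℝ) ≤ s.cuts.length := by positivity
  constructor
  · intro x hx
    have := h.width hr.le (fun y hy => h.Kp_subset (hx hy)) hH
    nlinarith
  · by_contra hp
    have := h.width_of_far hV hp hH
    nlinarith

/-! ### The potential along an execution -/

lemma Valid.potential_init (hV : Valid K I) : 0 ≤ (init I).potential := by
  have hd : (cut₁ I).dist (init I).z = 1 / √3 := by
    rw [show (init I).z = (1 / √3) • (cut₁ I).a from rfl, Cut.dist, inner_smul_right,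
      real_inner_self_eq_norm_sq, hV.norm_cut₁]
    simp [cut₁]
  have hn := hV.gradForm_init.1.2
  have h1 := Real.log_nonpos (one_sub_normSq_pos hn).le (by nlinarith [norm_nonneg (init I).z])
  rw [State.potential, show (init I).cuts = [cut₁ I] from rfl, F_cons, hd]
  simp only [F, List.map_nil, List.sum_nil, List.map_cons, List.sum_cons]
  rw [show (cut₁ I).kappa = 1 / √3 from rfl]
  linarith

lemma Reach.spec (hV : Valid K I) {i m : ℕ} (h : Reach I i m s) :
    Inv K I s ∧ 0.003 * (i : ℝ) ≤ s.potential ∧ m ≤ i := by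
  induction h with
  | start => exact ⟨hV.inv_init, by simpa using hV.potential_init, le_rfl⟩
  | @next i m s s' B _ _ hE hR ih =>
    obtain ⟨h1, h2, h3⟩ := ih
    refine ⟨h1.step hV hE hR, ?_, ?_⟩
    · have := h1.potential_step hV hE hR
      push_cast
      linarith
    · have : B.calls ≤ 1 := by cases B <;> simp [Branch.calls]
      omega

lemma F_add_sum_log_le {L : List (Cut n)} {x : E n} {c : ℝ}
    (h : ∀ H ∈ L, Real.log H.kappa - Real.log (H.dist x) ≤ c) :
    F L x + (L.map fun H => Real.log H.kappa).sum ≤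
      L.length * c - Real.log (1 - ‖x‖ ^ 2) := by
  induction L with
  | nil => simp [F]
  | cons H L ih =>
    have h1 := ih fun G hG => h G (List.mem_cons_of_mem _ hG)
    have h2 := h H List.mem_cons_self
    rw [F_cons, List.map_cons, List.sum_cons, List.length_cons]
    push_cast
    linarith

/-! ### Size of the parameters and the upper bound on the potential -/

lemma Valid.inv_r (hV : Valid K I) : 1 / I.r = 5 / 2 * (I.R / I.δ) := by
  have := hV.R_pos; have := hV.δ_pos
  rw [Input.r]; field_simp

lemma Valid.one_le_ratio (hV : Valid K I) : 1 ≤ I.R / I.δ := by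
  rw [le_div_iff₀ hV.δ_pos]; linarith [hV.δ_le]

lemma Input.u_mul_log_two (I : Input n) :
    I.u * Real.log 2 = 2 * Real.log n + Real.log (1 / I.r) := by
  have : Real.log 2 ≠ 0 := by have := Real.log_two_gt_d9; positivity
  rw [Input.u, Real.logb, Real.logb]; field_simp

lemma Valid.three_le_u (hV : Valid K I) : 3 ≤ I.u := by
  have h1 := I.u_mul_log_two
  have h2 : Real.log 2 ≤ Real.log n := Real.log_le_log two_pos (by exact_mod_cast hV.two_le)
  have h3 : Real.log 2 ≤ Real.log (1 / I.r) := by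
    refine Real.log_le_log two_pos ?_
    rw [hV.inv_r]; linarith [hV.one_le_ratio]
  have h4 := Real.log_two_gt_d9
  nlinarith

lemma Valid.six_le_nu (hV : Valid K I) : 6 ≤ n * I.u := by
  have h1 := hV.three_le_u
  have h2 : (2 : ℝ) ≤ n := by exact_mod_cast hV.two_le
  nlinarith

lemma Valid.nu_le (hV : Valid K I) : n * I.u ≤ n * I.u * I.R / I.δ := by
  have h1 := hV.six_le_nu
  have h2 := hV.one_le_ratio
  rw [mul_div_assoc]
  exact le_mul_of_one_le_right (by linarith) h2

/-- With X = nuR/δ, each of fewer than 1078nu cuts contributes at most 7 log X and the ball term at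
most 5 log X; 7551 = 7·1078 + 5. -/
lemma Inv.potential_le (hV : Valid K I) (h : Inv K I s) (h1 : ¬ s.Stop1 I) (h2 : ¬ s.Stop2 I) :
    s.potential ≤ 7551 * (n * I.u * Real.log (n * I.u * I.R / I.δ)) ∧
      0 < n * I.u * Real.log (n * I.u * I.R / I.δ) := by
  have hnu := hV.six_le_nu
  have hX := hV.nu_le
  have hratio := hV.one_le_ratio
  have hr := hV.r_pos
  have hXe : n * I.u * I.R / I.δ = n * I.u * (I.R / I.δ) := mul_div_assoc _ _ _
  set X := n * I.u * I.R / I.δ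
  have hX6 : 6 ≤ X := hnu.trans hX
  have hlX : 0 < Real.log X := Real.log_pos (by linarith)
  have hY : Real.log X ≤ n * I.u * Real.log X := le_mul_of_one_le_left hlX.le (by linarith)
  have hlen : (s.cuts.length : ℝ) ≤ 1078 * (n * I.u) := by
    rw [State.Stop1, not_le, ν] at h1
    linarith
  have hz := one_sub_normSq_pos h.mem.2
  have hc : ∀ H ∈ s.cuts, Real.log H.kappa - Real.log (H.dist s.z) ≤ 7 * Real.log X := by
    intro H hH
    have hd := h.mem.1 H hH
    have hk := (h.good H hH).kappa_pos
    have hk4 := (h.good H hH).kappa_le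
    have h3 : 2 * I.r ≤ H.dist s.z / (1 - ζ₀) * (3 * s.cuts.length + 4) := by
      by_contra! hlt
      exact h2 ⟨H, hH, hlt⟩
    have h4 : H.dist s.z / (1 - ζ₀) ≤ H.dist s.z / 0.99 := by
      have := ζ₀_le
      gcongr
      linarith
    have h5 : 2 * I.r ≤ H.dist s.z / 0.99 * (3235 * (n * I.u)) :=
      h3.trans (by gcongr; linarith)
    -- The ratio is at most 16340·X, and X ≥ 6 lets X⁶ absorb the constant.
    have h6 : H.kappa / H.dist s.z ≤ X ^ 7 := by
      rw [div_le_iff₀ hd]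
      have h7 : 4 ≤ H.dist s.z * (6536 * (n * I.u)) * (1 / I.r) := by
        rw [mul_one_div, le_div_iff₀ hr]
        norm_num at h5
        have : 0 < H.dist s.z * (n * I.u) := by positivity
        linarith
      rw [hV.inv_r] at h7
      have h8 : H.dist s.z * (6536 * (n * I.u)) * (5 / 2 * (I.R / I.δ)) =
          16340 * (X * H.dist s.z) := by rw [hXe]; ring
      rw [h8] at h7
      have h9 : (6 : ℝ) ^ 6 ≤ X ^ 6 := by gcongr
      have h10 : 0 < X * H.dist s.z := by positivity
      calc H.kappa ≤ 16340 * (X * H.dist s.z) := hk4.trans h7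
        _ ≤ X ^ 6 * (X * H.dist s.z) := by gcongr; linarith
        _ = X ^ 7 * H.dist s.z := by ring
    rw [← Real.log_div hk.ne' hd.ne']
    calc Real.log (H.kappa / H.dist s.z) ≤ Real.log (X ^ 7) := Real.log_le_log (by positivity) h6
      _ = 7 * Real.log X := by rw [Real.log_pow]; norm_num
  have hb : -Real.log (1 - ‖s.z‖ ^ 2) ≤ 5 * Real.log X := by
    obtain ⟨v, hv, hg, hq⟩ := exists_centre h.mem h.lam_lt
    have h3 := one_sub_normSq_centre hv hg fun H hH => (h.good H hH).b_le
    have h4 := one_sub_normSq_add_le h.mem v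
    have h5 : √(sqn s.cuts s.z v) ≤ 1 := by
      linarith [hq.trans (q_le_ζ₀ h.lam_lt), ζ₀_le]
    have h6 : 2 / ((s.cuts.length : ℝ) + 2) ≤ (1 - ‖s.z‖ ^ 2) * 2 :=
      h3.trans (h4.trans (by gcongr; linarith))
    rw [div_le_iff₀ (by positivity)] at h6
    have h7 : (1 - ‖s.z‖ ^ 2)⁻¹ ≤ X ^ 5 := by
      rw [inv_le_iff_one_le_mul₀ hz]
      have h9 : (6 : ℝ) ^ 4 ≤ X ^ 4 := by gcongr
      have h8 : (s.cuts.length : ℝ) + 2 ≤ X ^ 5 := by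
        calc (s.cuts.length : ℝ) + 2 ≤ 1079 * X := by linarith
          _ ≤ X ^ 4 * X := by gcongr; linarith
          _ = X ^ 5 := by ring
      nlinarith
    rw [← Real.log_inv]
    calc Real.log (1 - ‖s.z‖ ^ 2)⁻¹ ≤ Real.log (X ^ 5) := Real.log_le_log (by positivity) h7
      _ = 5 * Real.log X := by rw [Real.log_pow]; norm_num
  refine ⟨?_, by positivity⟩
  have h3 := F_add_sum_log_le hc
  rw [State.potential]
  have h4 : s.cuts.length * (7 * Real.log X) ≤ 1078 * (n * I.u) * (7 * Real.log X) := by gcongr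
  linarith

/-! ### The first stopping condition -/

/-- A lower bound for the reference distances while `p` is far from `K`. -/
def kappaMin (I : Input n) : ℝ := 2 * I.r * (1 - ζ₀) / (3 * (ν * n * I.u + 2))

lemma Valid.kappaMin_pos (hV : Valid K I) : 0 < kappaMin I := by
  have h1 := hV.six_le_nu
  have h2 := hV.r_pos
  have h3 := ζ₀_le
  have h4 : 0 < 1 - ζ₀ := by linarith
  have h5 : 0 < ν * n * I.u + 2 := by rw [ν, mul_assoc]; positivity
  rw [kappaMin]; positivity

lemma log_1079_le : Real.log 1079 ≤ 7 := by
  rw [Real.log_le_iff_le_exp (by norm_num)]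
  have h1 := Real.exp_one_gt_d9
  have h2 : Real.exp 7 = Real.exp 1 ^ 7 := by rw [← Real.exp_nat_mul]; norm_num
  rw [h2]
  calc (1079 : ℝ) ≤ 2.718 ^ 7 := by norm_num
    _ ≤ Real.exp 1 ^ 7 := by gcongr; linarith

/-- The Gram determinant cannot grow as often as the first stopping condition asks for. -/
lemma Valid.not_card_bound (hV : Valid K I) {h : ℕ} (h1 : ν * n * I.u ≤ h)
    (h2 : (h : ℝ) ≤ ν * n * I.u + 1)
    (hb : (1.01 : ℝ) ^ h ≤ (n + h * (kappaMin I ^ 2)⁻¹) ^ n) : False := by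
  have hnu := hV.six_le_nu
  have hr := hV.r_pos
  have hu := hV.three_le_u
  have hn : (2 : ℝ) ≤ n := by exact_mod_cast hV.two_le
  have hζ := ζ₀_le
  have hr1 : I.r ≤ 1 := by
    have := hV.inv_r
    have h3 := hV.one_le_ratio
    rw [← one_div_one_div I.r, this, div_le_one (by positivity)]; linarith
  have hνe : ν * n * I.u = 1078 * (n * I.u) := by rw [ν]; ring
  rw [hνe] at h1 h2
  obtain ⟨M, hM⟩ : ∃ M, M = 1078 * (n * I.u) + 2 := ⟨_, rfl⟩
  have hM0 : 6000 ≤ M := by linarith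
  have hκ : (kappaMin I ^ 2)⁻¹ ≤ 2.4 * M ^ 2 / I.r ^ 2 := by
    have h4 : 0.66 * I.r / M ≤ kappaMin I := by
      rw [kappaMin, hνe, ← hM, div_le_div_iff₀ (by positivity) (by positivity)]
      have : 0 < I.r * M := by positivity
      nlinarith
    have h5 : (kappaMin I ^ 2)⁻¹ ≤ ((0.66 * I.r / M) ^ 2)⁻¹ := by gcongr
    refine h5.trans ?_
    rw [div_pow, inv_div, mul_pow, div_le_div_iff₀ (by positivity) (by positivity)]
    have : 0 < M ^ 2 * I.r ^ 2 := by positivity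
    norm_num
    linarith
  have hB : n + h * (kappaMin I ^ 2)⁻¹ ≤ 2.5 * M ^ 3 / I.r ^ 2 := by
    have h4 : h * (kappaMin I ^ 2)⁻¹ ≤ M * (2.4 * M ^ 2 / I.r ^ 2) := by gcongr; linarith
    have h5 : (n : ℝ) ≤ 0.1 * M ^ 3 / I.r ^ 2 := by
      have h6 : (n : ℝ) ≤ M := by nlinarith
      rw [le_div_iff₀ (by positivity)]
      calc (n : ℝ) * I.r ^ 2 ≤ M * 1 ^ 2 := by gcongr
        _ ≤ 0.1 * M ^ 3 := by nlinarith [sq_nonneg M]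
    refine (add_le_add h5 h4).trans (le_of_eq ?_)
    field_simp; norm_num
  have hB0 : 0 < n + h * (kappaMin I ^ 2)⁻¹ := by positivity
  have hlog := Real.log_le_log (by positivity) hb
  rw [Real.log_pow, Real.log_pow] at hlog
  have hlog2 := Real.log_le_log hB0 hB
  rw [Real.log_div (by positivity) (by positivity), Real.log_mul (by norm_num) (by positivity),
    Real.log_pow, Real.log_pow] at hlog2
  have hlogM : Real.log M ≤ 7 + Real.log n + Real.log I.u := by
    have h3 : M ≤ 1079 * (n * I.u) := by linarith
    have h4 := Real.log_le_log (by linarith) h3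
    rw [Real.log_mul (by norm_num) (by positivity), Real.log_mul (by positivity)
      (by positivity)] at h4
    linarith [log_1079_le]
  have hlogu := log_le_of_pos (x := I.u) (c := 3) (by linarith) (by norm_num)
  have hlog3 := log_le_half_sub_inv (x := 3) (by norm_num)
  have hlog25 := log_le_half_sub_inv (x := 2.5) (by norm_num)
  have hul := I.u_mul_log_two
  rw [one_div, Real.log_inv] at hul
  have hl2 := Real.log_two_lt_d9
  have hlogn : 0 ≤ Real.log n := Real.log_nonneg (by linarith)
  have h101 := Real.le_log_one_add_of_nonneg (x := 0.01) (by norm_num)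
  -- By the definition of u, 3 log n + 2 log(1/r) ≤ 2u log 2; the remaining 3 log u is linearised at
  -- u = 3.
  have h6 : Real.log (n + h * (kappaMin I ^ 2)⁻¹) ≤ 23.1 + 2.4 * I.u := by
    push_cast at hlog2
    norm_num at hlog3 hlog25 hlog2
    have : I.u * Real.log 2 ≤ I.u * 0.7 := by gcongr; linarith
    norm_num at this ⊢
    have h7 : I.u * Real.log 2 ≤ I.u * 0.6931471808 := by gcongr
    norm_num at h7
    linarith
  have h8 : (0.00995 : ℝ) ≤ Real.log 1.01 := by norm_num at h101 ⊢; linarith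
  have h9 : 1078 * (n * I.u) * 0.00995 ≤ h * Real.log 1.01 := by gcongr
  have h10 : n * Real.log (n + h * (kappaMin I ^ 2)⁻¹) ≤ n * (23.1 + 2.4 * I.u) := by gcongr
  have h11 : (n : ℝ) * (1078 * I.u * 0.00995) ≤ n * (23.1 + 2.4 * I.u) := by
    refine le_trans (le_of_eq ?_) (h9.trans (hlog.trans h10)); ring
  -- What is left, 10.7u ≤ 23.1 + 2.4u, fails for u ≥ 3; this is where the size of ν matters.
  have h12 := le_of_mul_le_mul_left h11 (by linarith)
  norm_num at h12
  linarith

open Classical in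
/-- The additional invariant of the main loop while `p` is far from `K`. -/
structure FarInv (I : Input n) (s : State n) : Prop where
  kappa : ∀ H ∈ s.cuts, kappaMin I ≤ H.kappa
  gram : GramGood (s.cuts : Multiset (Cut n)) ∨
    (∀ H ∈ s.cuts, ¬ (2 < H.μ s.z ∧ sig s.cuts H s.z < σ₀)) ∧
      GramGood (Multiset.filter (fun H => H.μ s.z ≤ 2) (s.cuts : Multiset (Cut n)))
  length : (s.cuts.length : ℝ) < ν * n * I.u

lemma Inv.kappaMin_le_dist (hV : Valid K I) (h : Inv K I s) (hp : I.p ∉ nbhd K I.δ)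
    (hl : (s.cuts.length : ℝ) ≤ ν * n * I.u + 1) {H : Cut n} (hH : H ∈ s.cuts) :
    kappaMin I ≤ H.dist s.z := by
  have h1 := h.width_of_far hV hp hH
  have hζ : 0 < 1 - ζ₀ := by linarith [ζ₀_le]
  have hd := h.mem.1 H hH
  have hpos : 0 < ν * n * I.u + 2 := by
    rw [ν, mul_assoc]; linarith [hV.six_le_nu]
  have h2 : 2 * (I.r / 3) ≤ (ν * n * I.u + 2) * (H.dist s.z / (1 - ζ₀)) :=
    h1.trans (mul_le_mul_of_nonneg_right (by linarith) (div_pos hd hζ).le)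
  rw [← mul_div_assoc (ν * n * I.u + 2), le_div_iff₀ hζ] at h2
  rw [kappaMin, div_le_iff₀ (by positivity)]
  linarith

lemma Valid.farInv_init (hV : Valid K I) (hp : I.p ∉ nbhd K I.δ) : FarInv I (init I) where
  kappa := by
    intro H hH
    have h1 := hV.inv_init.kappaMin_le_dist hV hp (by
      have h := hV.six_le_nu
      rw [show (init I).cuts = [cut₁ I] from rfl, ν, mul_assoc]
      simp; linarith) hH
    rw [show (init I).cuts = [cut₁ I] from rfl, List.mem_singleton] at hH
    subst hH
    refine h1.trans (le_of_eq ?_)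
    rw [show (init I).z = (1 / √3) • (cut₁ I).a from rfl, Cut.dist, inner_smul_right,
      real_inner_self_eq_norm_sq, hV.norm_cut₁]
    simp [cut₁]
  gram := by
    left
    have ha := hV.norm_cut₁
    have ha0 : (cut₁ I).a ≠ 0 := by
      intro h; rw [h, norm_zero] at ha; exact zero_ne_one ha
    refine (gramGood_zero.cons hV.goodCut₁.kappa_pos ha0 ?_ :
      GramGood (cut₁ I ::ₘ 0))
    rw [real_inner_self_eq_norm_sq, ha, show (cut₁ I).kappa = 1 / √3 from rfl, div_pow,
      Real.sq_sqrt (by norm_num)]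
    simp only [gramForm, Multiset.map_zero, Multiset.sum_zero, ha]
    norm_num
  length := by
    have h := hV.six_le_nu
    rw [show (init I).cuts = [cut₁ I] from rfl, ν, mul_assoc]
    simp; linarith

open Classical in
lemma FarInv.gram_filter (hf : FarInv I s) :
    GramGood (Multiset.filter (fun H => H.μ s.z ≤ 2) (s.cuts : Multiset (Cut n))) := by
  rcases hf.gram with h | h
  · exact h.mono (Multiset.filter_le _ _)
  · exact h.2

/-- The second alternative of `FarInv.gram` describes a run of resets: z and F stay fixed, so no cut
becomes discardable, and cuts still awaiting a reset are not counted. In Case 2 every cut is counted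
again. -/
lemma FarInv.step (hV : Valid K I) (hp : I.p ∉ nbhd K I.δ) (h : Inv K I s) (hf : FarInv I s)
    {B : Branch s} (hE : B.Enabled I) (hR : B.Result I s s') : FarInv I s' := by
  classical
  have h' := h.step hV hE hR
  have hz := h.mem
  have hgram : ∀ w, gramForm
      (Multiset.filter (fun H => H.μ s.z ≤ 2) (s.cuts : Multiset (Cut n))) w ≤
        4 * sqn s.cuts s.z w := fun w =>
    gramForm_filter_le hz _ (fun H hH => (h.good H hH).kappa_pos) (fun H _ hH => hH) w
  cases B with
  | discard j =>
    obtain ⟨hc, -⟩ := hR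
    refine ⟨fun H hH => hf.kappa H ?_, ?_, ?_⟩
    · rw [hc] at hH; exact List.mem_of_mem_eraseIdx hH
    · left
      rcases hf.gram with h1 | h1
      · rw [hc]
        exact h1.mono (List.eraseIdx_sublist _ _).subperm
      · exact absurd hE (h1.1 _ (List.get_mem _ _))
    · refine lt_of_le_of_lt ?_ hf.length
      rw [hc]
      exact_mod_cast (List.eraseIdx_sublist _ _).length_le
  | reset j =>
    have hmin : ∀ {H}, H ∈ s'.cuts → kappaMin I ≤ H.dist s'.z := fun {H} hH =>
      h'.kappaMin_le_dist hV hp (by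
        rw [hR.2, List.length_set]; linarith [hf.length]) hH
    obtain ⟨hzz, hc⟩ := hR
    have hj : s.cuts.get j ∈ s.cuts := List.get_mem _ _
    have hd := hz.1 _ hj
    have hset := set_perm s.cuts j
      ⟨(s.cuts.get j).a, (s.cuts.get j).b, (s.cuts.get j).dist s.z⟩
    have hF := F_set s.cuts j ((s.cuts.get j).dist s.z)
    have ha := (h.good _ hj).norm
    rw [hc, hzz] at hmin
    set G : Cut n := ⟨(s.cuts.get j).a, (s.cuts.get j).b, (s.cuts.get j).dist s.z⟩
    have hμG : G.μ s.z = 1 := div_self hd.ne'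
    refine ⟨?_, Or.inr ⟨?_, ?_⟩, ?_⟩
    · intro H hH
      rw [hc] at hH
      rcases List.mem_or_eq_of_mem_set hH with h1 | rfl
      · exact hf.kappa H h1
      · exact hmin (H := G) hH
    · intro H hH
      rw [hc] at hH
      rw [hc, hzz, sig_congr hF]
      rcases List.mem_or_eq_of_mem_set hH with h1 | rfl
      · exact hE.2 H h1
      · rw [hμG]; norm_num
    · rw [hc, hzz, Multiset.coe_eq_coe.2 hset, ← Multiset.cons_coe,
        Multiset.filter_cons_of_pos _ (by rw [hμG]; norm_num)]
      have hle : Multiset.filter (fun H => H.μ s.z ≤ 2)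
          ((s.cuts.eraseIdx j : List (Cut n)) : Multiset (Cut n)) ≤
          Multiset.filter (fun H => H.μ s.z ≤ 2) (s.cuts : Multiset (Cut n)) :=
        Multiset.filter_le_filter _ (List.eraseIdx_sublist _ _).subperm
      have ha0 : (s.cuts.get j).a ≠ 0 := by
        intro h0; rw [h0, norm_zero] at ha; exact zero_ne_one ha
      have hQ := inner_hessInv_pos hz ha0
      have hσ : ¬ sig s.cuts (s.cuts.get j) s.z < σ₀ := fun h0 => hE.2 _ hj ⟨hE.1, h0⟩
      rw [not_lt, sig, le_div_iff₀ (by positivity), σ₀] at hσ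
      refine (hf.gram_filter.mono hle).cons hd
        (w := hessInv s.cuts s.z (s.cuts.get j).a) ?_ ?_
      · intro h0; rw [h0, inner_zero_right] at hQ; exact hQ.false
      · have h1 := (gramForm_mono hle _).trans (hgram (hessInv s.cuts s.z (s.cuts.get j).a))
        rw [sqn_hessInv hz] at h1
        set Q := inner ℝ (s.cuts.get j).a (hessInv s.cuts s.z (s.cuts.get j).a)
        show 0.01 * (s.cuts.get j).dist s.z ^ 2 * _ ≤ Q ^ 2
        -- The cut was not discardable, so Q ≥ 0.08·dist².
        calc 0.01 * (s.cuts.get j).dist s.z ^ 2 * _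
            ≤ 0.01 * (s.cuts.get j).dist s.z ^ 2 * (4 * Q) := by gcongr
          _ ≤ Q ^ 2 := by nlinarith
    · rw [hc, List.length_set]; exact hf.length
  | add a =>
    have hcase : s.Case2 := hE.1
    have hna : ‖a‖ = 1 := hE.2.2.1
    obtain ⟨β, hβ, hγ, hc, hr⟩ := hR
    obtain ⟨-, h2, -, h4, h5⟩ := h.add_spec hV hE hβ hγ hc hr
    have hperm := hc ▸ List.perm_append_singleton (⟨a, β, inner ℝ a s'.z - β⟩ : Cut n) s.cuts
    have hlen : s'.cuts.length = s.cuts.length + 1 := by rw [hc]; simp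
    have hfl := hf.length
    have hlen' : (s'.cuts.length : ℝ) ≤ ν * n * I.u + 1 := by
      rw [hlen]; push_cast; linarith
    have hmin : ∀ {H}, H ∈ s'.cuts → kappaMin I ≤ H.dist s'.z := fun {H} hH =>
      h'.kappaMin_le_dist hV hp hlen' hH
    set G : Cut n := ⟨a, β, inner ℝ a s'.z - β⟩
    have hkappa : ∀ H ∈ s'.cuts, kappaMin I ≤ H.kappa := by
      intro H hH
      have hH' := hH
      rw [hc, List.mem_append, List.mem_singleton] at hH'
      rcases hH' with h1 | rfl
      · exact hf.kappa H h1
      · exact hmin hH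
    have hfilter : Multiset.filter (fun H => H.μ s.z ≤ 2) (s.cuts : Multiset (Cut n)) =
        s.cuts := Multiset.filter_eq_self.2 fun H hH => hcase H hH
    have hgood : GramGood (s'.cuts : Multiset (Cut n)) := by
      rw [Multiset.coe_eq_coe.2 hperm, ← Multiset.cons_coe]
      have ha0 : a ≠ 0 := by
        intro h0; rw [h0, norm_zero] at hna; exact zero_ne_one hna
      have hQ := inner_hessInv_pos hz ha0
      have h6 := hf.gram_filter
      rw [hfilter] at h6
      refine h6.cons h2.kappa_pos (w := hessInv s.cuts s.z a) ?_ ?_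
      · intro h0; rw [h0, inner_zero_right] at hQ; exact hQ.false
      · have h7 := hgram (hessInv s.cuts s.z a)
        rw [hfilter, sqn_hessInv hz] at h7
        have hk : G.kappa ≤ 5 / 4 * -β := by rw [h5, zero_sub] at h4; exact h4
        have hk0 := h2.kappa_pos
        rw [h5, zero_sub, div_eq_iff (pow_ne_zero 2 (neg_ne_zero.2 hβ.ne)), γ₀] at hγ
        show 0.01 * G.kappa ^ 2 * _ ≤ (inner ℝ a (hessInv s.cuts s.z a)) ^ 2
        set Q := inner ℝ a (hessInv s.cuts s.z a)
        -- Q = β²/16 and κ ≤ 5|β|/4 give 0.01·(25/16)·4β² = Q, so γ₀ fixes the factor 1.01 with no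
        -- slack.
        calc 0.01 * G.kappa ^ 2 * _ ≤ 0.01 * G.kappa ^ 2 * (4 * Q) := by gcongr
          _ ≤ 0.01 * (5 / 4 * -β) ^ 2 * (4 * Q) := by gcongr
          _ = Q ^ 2 := by rw [hγ]; ring
    refine ⟨hkappa, Or.inl hgood, ?_⟩
    -- The length was below νnu before the addition, so it now lies within one of the threshold.
    by_contra! hge
    have hb := hgood.card_bound hV.kappaMin_pos fun H hH =>
      ⟨(h'.good H hH).norm, hkappa H hH⟩
    exact hV.not_card_bound hge hlen' hb

lemma Reach.farInv (hV : Valid K I) (hp : I.p ∉ nbhd K I.δ) {i m : ℕ} (h : Reach I i m s) :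
    FarInv I s := by
  induction h with
  | start => exact hV.farInv_init hp
  | next B hr _ hE hR ih => exact ih.step hV hp (hr.spec hV).1 hE hR

lemma Reach.stop1_sound (hV : Valid K I) {i m : ℕ} (h : Reach I i m s) (hs : s.Stop1 I) :
    I.p ∈ nbhd K I.δ := by
  by_contra hp
  exact (h.farInv hV hp).length.not_ge hs

/-! ### The number of oracle calls -/

/-- The bound on the number of oracle calls. -/
def callBound : MvPolynomial (Fin 2) ℝ :=
  MvPolynomial.C 3000000 * (MvPolynomial.X 0 *
    (3 * MvPolynomial.X 0 + 2 * MvPolynomial.X 1 + 2) *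
      (4 * MvPolynomial.X 0 + 3 * MvPolynomial.X 1 + 2)) + 1

/-- Bounding log n and log u linearly leaves a polynomial in n and log(R/δ). The final 1 pays for
the last iteration. -/
lemma Valid.le_callBound (hV : Valid K I) :
    3000000 * (n * I.u * Real.log (n * I.u * I.R / I.δ)) + 1 ≤
      MvPolynomial.eval ![(n : ℝ), Real.log (I.R / I.δ)] callBound := by
  have hratio := hV.one_le_ratio
  have hu3 := hV.three_le_u
  have hn : (2 : ℝ) ≤ n := by exact_mod_cast hV.two_le
  have hul := I.u_mul_log_two
  rw [hV.inv_r, Real.log_mul (by norm_num) (by positivity)] at hul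
  have hX : Real.log (n * I.u * I.R / I.δ) =
      Real.log n + Real.log I.u + Real.log (I.R / I.δ) := by
    rw [mul_div_assoc, Real.log_mul (by positivity) (by positivity),
      Real.log_mul (by positivity) (by positivity)]
  rw [hX]
  have hl : 0 ≤ Real.log (I.R / I.δ) := Real.log_nonneg hratio
  set l := Real.log (I.R / I.δ)
  have h1 := Real.log_le_sub_one_of_pos (show (0 : ℝ) < n by linarith)
  have h2 := Real.log_le_sub_one_of_pos (show (0 : ℝ) < I.u by linarith)
  have h3 := log_le_half_sub_inv (x := 5 / 2) (by norm_num)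
  have h4 := Real.log_two_gt_d9
  norm_num at h3
  have h5 : I.u ≤ 3 * n + 2 * l + 2 := by
    have : I.u * 0.6931471803 ≤ I.u * Real.log 2 := by gcongr
    norm_num at this
    linarith
  have h6 : Real.log n + Real.log I.u + l ≤ 4 * n + 3 * l + 2 := by linarith
  have h7 : 0 ≤ Real.log n := Real.log_nonneg (by linarith)
  have h8 : 0 ≤ Real.log I.u := Real.log_nonneg (by linarith)
  have h9 : n * I.u * (Real.log n + Real.log I.u + l) ≤
      n * (3 * n + 2 * l + 2) * (4 * n + 3 * l + 2) := by gcongr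
  simp only [callBound, map_add, map_mul, MvPolynomial.eval_X, map_one,
    map_ofNat, Matrix.cons_val_zero, Matrix.cons_val_one]
  linarith

end Execution

end CutPlane

end

/-! ### Assembly of the main theorem -/

theorem mainTheorem1 :
    ∃ C : ℝ, 0 < C ∧ ∃ Q : MvPolynomial (Fin 2) ℝ,
      ∀ (n : ℕ), 2 ≤ n → ∀ (K : Set (CutPlane.E n)) (I : CutPlane.Input n),
        Convex ℝ K → (∃ s > 0, Metric.closedBall 0 s ⊆ K) → K ⊆ Metric.closedBall 0 I.R →
        0 < I.δ → I.δ ≤ I.R → I.p ≠ 0 → ‖I.p‖ ≤ I.R →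
        CutPlane.IsWeakOptOracle K I.oracle →
        -- Stopping Condition 2 is met in time, unless something else happens first
        (∀ (i m : ℕ) (s : CutPlane.State n), CutPlane.Reach I i m s → ¬ s.Stop1 I →
          C * (n * I.u * Real.log (n * I.u * I.R / I.δ)) ≤ i → s.Stop2 I) ∧
        -- if it is met, the set of separating vectors is too small and the assertion is correct
        (∀ (i m : ℕ) (s : CutPlane.State n), CutPlane.Reach I i m s → s.Stop2 I →
          (∀ x : CutPlane.E n, ¬ Metric.closedBall x I.r ⊆ CutPlane.Kp K I) ∧
          I.p ∈ CutPlane.nbhd K I.δ) ∧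
        -- every iteration can be carried out, whatever choices are made
        (∀ (i m : ℕ) (s : CutPlane.State n), CutPlane.Active I i m s →
          (s.Accepts I ∨ ∃ B : CutPlane.Branch s, B.Enabled I) ∧
          ∀ B : CutPlane.Branch s, B.Enabled I →
            ∃ s' : CutPlane.State n, B.Result I s s') ∧
        -- no execution is longer than the bound
        (∀ (i m : ℕ) (s : CutPlane.State n), CutPlane.Active I i m s →
          (i : ℝ) < C * (n * I.u * Real.log (n * I.u * I.R / I.δ))) ∧
        -- every answer is correct, after polynomially many oracle calls
        (∀ (i m : ℕ) (ans : CutPlane.Answer n), CutPlane.Halts I i m ans →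
          ans.Correct K I.p I.δ ∧
          (m : ℝ) ≤ MvPolynomial.eval ![(n : ℝ), Real.log (I.R / I.δ)] Q) := by
  -- The potential argument needs 7551/0.003 = 2517000; the excess makes the contradiction strict.
  refine ⟨3000000, by norm_num, CutPlane.callBound, ?_⟩
  intro n hn K I hconv hball hsub hδ hδR hp0 hpR hO
  have hV : CutPlane.Valid K I := by
    obtain ⟨t, ht, hts⟩ := hball
    exact ⟨hn, hconv, hts (Metric.mem_closedBall_self ht.le), hsub, hδ, hδR, hp0, hpR, hO⟩
  have part1 : ∀ (i m : ℕ) (s : CutPlane.State n), CutPlane.Reach I i m s → ¬ s.Stop1 I →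
      3000000 * (n * I.u * Real.log (n * I.u * I.R / I.δ)) ≤ i → s.Stop2 I := by
    intro i m s hr h1 hi
    by_contra h2
    obtain ⟨hinv, hpot, -⟩ := hr.spec hV
    obtain ⟨h3, h4⟩ := hinv.potential_le hV h1 h2
    norm_num at hpot
    linarith
  have part4 : ∀ (i m : ℕ) (s : CutPlane.State n), CutPlane.Active I i m s →
      (i : ℝ) < 3000000 * (n * I.u * Real.log (n * I.u * I.R / I.δ)) := by
    intro i m s ⟨hr, hns⟩
    rcases Nat.eq_zero_or_pos i with rfl | hi
    · have h1 := hV.six_le_nu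
      have h2 := hV.nu_le
      have h3 := Real.log_pos (show 1 < n * I.u * I.R / I.δ by linarith)
      have : 0 < n * I.u := by linarith
      rw [Nat.cast_zero]
      positivity
    · by_contra! hge
      exact (hns hi).2 (part1 i m s hr (hns hi).1 hge)
  have hcalls := hV.le_callBound
  refine ⟨part1, fun i m s hr hs => (hr.spec hV).1.stop2_sound hV hs,
    fun i m s hA => ⟨(hA.1.spec hV).1.exists_branch hV,
      fun B hE => (hA.1.spec hV).1.exists_result hV hE⟩, part4, ?_⟩
  intro i m ans hH
  cases hH with
  | @found i m s hA hacc =>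
    obtain ⟨hinv, -, hm⟩ := hA.1.spec hV
    refine ⟨⟨hinv.norm_c, fun x hx => ?_⟩, ?_⟩
    · have h1 := (hV.oracle_mem s).2 x hx
      have h2 := hacc.2
      have : I.ε = I.δ / 5 := rfl
      linarith
    · have h1 := part4 i m s hA
      have h2 : (m : ℝ) ≤ i := by exact_mod_cast hm
      push_cast
      linarith
  | @stopped i m s hr hi hs =>
    refine ⟨?_, ?_⟩
    · rcases hs with hs | hs
      · exact hr.stop1_sound hV hs
      · exact ((hr.spec hV).1.stop2_sound hV hs).2
    · have hm : (m : ℝ) ≤ i := by exact_mod_cast (hr.spec hV).2.2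
      -- The halting state itself need not be active, so the length bound is applied to its
      -- predecessor.
      cases hr with
      | start => omega
      | @next i m s₀ _ B hr₀ hns hE hR =>
        have h1 := part4 _ _ _ ⟨hr₀, hns⟩
        push_cast at hm ⊢
        linarith
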